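/- Let $\phi:\mathbb D^2\to\mathbb D$ be a two-variable inner function, i.e. $\phi$ is holomorphic and for almost every $(\tau_1,\tau_2)\in\mathbb T^2$ the radial limit $\lim_{r\uparrow 1}\phi(r\tau_1,r\tau_2)$ exists and has modulus $1$. Let $H^2=H^2(\mathbb D^2)$ be the Hardy space of the bidisk, let $M_{z_j}$ be multiplication by $z_j$ on $H^2$, and put $\mathcal K_\phi=H^2\ominus\phi H^2$. Let $S_1^{\max}$ be the largest subspace of $\mathcal K_\phi$ that is invariant under $M_{z_1}$, and let $S_2^{\min}=\mathcal K_\phi\ominus S_1^{\max}$. Define the Hilbert function spaces $$\mathcal H(K_1^{\max})=S_1^{\max}\ominus z_1S_1^{\max},\qquad \mathcal H(K_2^{\min})=S_2^{\min}\ominus z_2S_2^{\min},$$ with reproducing kernels $K_1^{\max}$, $K_2^{\min}$. Write $k_{1,w}^{\max}=K_1^{\max}(\cdot,w)$ and $k_{2,w}^{\min}=K_2^{\min}(\cdot,w)$, put $\mathcal H_\phi=\mathcal H(K_2^{\min})\oplus\mathcal H(K_1^{\max})$, and let $P_1$, $P_2$ be the orthogonal projections of $H^2$ onto $\mathcal H(K_1^{\max})$,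 $\mathcal H(K_2^{\min})$. Then $\phi\in H^2$ (represented by a unique element of $H^2$), and there is a unique linear isometry $V$ of $\mathbb C\oplus\mathcal H_\phi$ such that for all $w\in\mathbb D^2$ $$V\begin{bmatrix}1\\ \overline{w_1}\,k_{2,w}^{\min}\\ \overline{w_2}\,k_{1,w}^{\max}\end{bmatrix}=\begin{bmatrix}\overline{\phi(w)}\\ k_{2,w}^{\min}\\ k_{1,w}^{\max}\end{bmatrix}.$$ Writing $V^*=\begin{bmatrix}A&B\\ C&D\end{bmatrix}$ with respect to $\mathbb C\oplus\mathcal H_\phi$, one has for every $w\in\mathbb D^2$ $$D\begin{bmatrix}k_{2,w}^{\min}\\ k_{1,w}^{\max}\end{bmatrix}=\begin{bmatrix}\overline{w_1}\,k_{2,w}^{\min}\\ \overline{w_2}\,k_{1,w}^{\max}\end{bmatrix}-\overline{\phi(w)}\,F,\qquad F=\begin{bmatrix}P_2M_{z_1}^*\phi\\ P_1M_{z_2}^*\phi\end{bmatrix}.$$ -/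

import Mathlib

open scoped ComplexConjugate InnerProductSpace ENNReal Topology

/-- The open unit bidisk in `ℂ²`. -/
def bidisk : Set (ℂ × ℂ) := Metric.ball 0 1 ×ˢ Metric.ball 0 1

theorem bidisk_fst (z : bidisk) : ‖z.1.1‖ < 1 := by
  have h := z.2.1
  simpa using h

theorem bidisk_snd (z : bidisk) : ‖z.1.2‖ < 1 := by
  have h := z.2.2
  simpa using h

/-- Two-variable inner functions with values in the open unit disk: holomorphic maps from the
bidisk to the disk whose radial limits exist and have modulus one at almost every point
`(exp (i θ₁), exp (i θ₂))` of the torus. -/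
structure IsInnerFunction (φ : ℂ × ℂ → ℂ) : Prop where
  differentiableOn : DifferentiableOn ℂ φ bidisk
  norm_lt_one : ∀ z ∈ bidisk, ‖φ z‖ < 1
  radial_limit : ∀ᵐ θ : ℝ × ℝ, ∃ c : ℂ, ‖c‖ = 1 ∧
    Filter.Tendsto (fun r : ℝ => φ (r * Complex.exp (θ.1 * Complex.I),
      r * Complex.exp (θ.2 * Complex.I))) (𝓝[<] 1) (𝓝 c)

/-- The Hardy space of the bidisk: square-summable families of Taylor coefficients,
with the `ℓ²` inner product. The instance `RKHS ℂ HardySpace bidisk ℂ` below identifies such a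
family with the holomorphic function `z ↦ ∑ a (m, n) z₁ ^ m z₂ ^ n`. -/
def HardySpace : Type := lp (fun _ : ℕ × ℕ => ℂ) 2

namespace HardySpace

theorem hasSum_of_eq {ι : Type*} {a b : ι → ℂ} {s : ℂ} (h : ∀ i, a i = b i) (ha : HasSum a s) :
    HasSum b s := funext h ▸ ha

noncomputable instance : NormedAddCommGroup HardySpace :=
  inferInstanceAs (NormedAddCommGroup (lp (fun _ : ℕ × ℕ => ℂ) 2))

noncomputable instance : InnerProductSpace ℂ HardySpace :=
  inferInstanceAs (InnerProductSpace ℂ (lp (fun _ : ℕ × ℕ => ℂ) 2))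

instance : CompleteSpace HardySpace :=
  inferInstanceAs (CompleteSpace (lp (fun _ : ℕ × ℕ => ℂ) 2))

/-- The Taylor coefficients of an element of the Hardy space. -/
def coeff (f : HardySpace) (p : ℕ × ℕ) : ℂ :=
  (show lp (fun _ : ℕ × ℕ => ℂ) 2 from f) p

/-- The element of the Hardy space with given square-summable Taylor coefficients. -/
def ofCoeff (a : ℕ × ℕ → ℂ) (ha : Memℓp a 2) : HardySpace :=
  (⟨a, ha⟩ : lp (fun _ : ℕ × ℕ => ℂ) 2)

theorem coeff_ofCoeff (a : ℕ × ℕ → ℂ) (ha : Memℓp a 2) : coeff (ofCoeff a ha) = a := rfl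

theorem memlp_coeff (f : HardySpace) : Memℓp (coeff f) 2 :=
  lp.memℓp (show lp (fun _ : ℕ × ℕ => ℂ) 2 from f)

theorem ext_coeff {f g : HardySpace} (h : ∀ p, coeff f p = coeff g p) : f = g :=
  lp.ext (funext h)

theorem coeff_add (f g : HardySpace) (p : ℕ × ℕ) :
    coeff (f + g) p = coeff f p + coeff g p := rfl

theorem coeff_smul (c : ℂ) (f : HardySpace) (p : ℕ × ℕ) :
    coeff (c • f) p = c * coeff f p := rfl

theorem coeff_zero (p : ℕ × ℕ) : coeff 0 p = 0 := rfl

theorem hasSum_inner (f g : HardySpace) :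
    HasSum (fun p => ⟪coeff f p, coeff g p⟫_ℂ) ⟪f, g⟫_ℂ :=
  lp.hasSum_inner (𝕜 := ℂ) (show lp (fun _ : ℕ × ℕ => ℂ) 2 from f) g

theorem memlp_iff (a : ℕ × ℕ → ℂ) : Memℓp a 2 ↔ Summable fun p => ‖a p‖ ^ 2 := by
  rw [memℓp_gen_iff (by norm_num)]
  norm_num

theorem hasSum_norm_sq (f : HardySpace) : HasSum (fun p => ‖coeff f p‖ ^ 2) (‖f‖ ^ 2) := by
  have h := lp.hasSum_norm (p := 2) (by norm_num) (show lp (fun _ : ℕ × ℕ => ℂ) 2 from f)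
  simp only [ENNReal.toReal_ofNat, Real.rpow_ofNat] at h
  exact h

theorem memlp_szego (z : bidisk) :
    Memℓp (fun p : ℕ × ℕ => conj z.1.1 ^ p.1 * conj z.1.2 ^ p.2) 2 := by
  rw [memlp_iff]
  have key : ∀ w : ℂ, ‖w‖ < 1 → Summable fun n : ℕ => ‖w‖ ^ (2 * n) := fun w hw => by
    simp only [pow_mul]
    exact summable_geometric_of_lt_one (by positivity) (by nlinarith [norm_nonneg w])
  have h := (key _ (bidisk_fst z)).mul_of_nonneg (key _ (bidisk_snd z))
    (fun _ => by positivity) (fun _ => by positivity)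
  refine h.congr fun p => ?_
  simp [mul_pow, ← pow_mul, mul_comm]

/-- The Szegő kernel function at `z`; it represents the evaluation at `z`. -/
noncomputable def szego (z : bidisk) : HardySpace :=
  ofCoeff (fun p => conj z.1.1 ^ p.1 * conj z.1.2 ^ p.2) (memlp_szego z)

/-- Evaluation at the points of the bidisk. -/
noncomputable def evalCLM : HardySpace →L[ℂ] (bidisk → ℂ) :=
  ContinuousLinearMap.pi fun z => innerSL ℂ (szego z)

/-- The value at `z` is the sum of the power series. -/
theorem hasSum_evalCLM (f : HardySpace) (z : bidisk) :
    HasSum (fun p : ℕ × ℕ => coeff f p * z.1.1 ^ p.1 * z.1.2 ^ p.2) (evalCLM f z) := by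
  have h := hasSum_inner (szego z) f
  refine hasSum_of_eq (fun p => ?_) h
  simp [szego, coeff_ofCoeff, mul_assoc]

/-- A power series in one variable that vanishes on the disk has zero coefficients. -/
theorem eq_zero_of_hasSum (a : ℕ → ℂ)
    (h : ∀ z : ℂ, ‖z‖ < 1 → HasSum (fun n => a n * z ^ n) 0) (n : ℕ) : a n = 0 := by
  have hp : HasFPowerSeriesOnBall (fun _ : ℂ => (0 : ℂ)) (FormalMultilinearSeries.ofScalars ℂ a)
      0 1 := by
    refine ⟨?_, by norm_num, ?_⟩
    · refine ENNReal.le_of_forall_nnreal_lt fun r hr => ?_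
      have hr' : (r : ℝ) < 1 := by exact_mod_cast hr
      refine FormalMultilinearSeries.le_radius_of_tendsto (l := 0) _ ?_
      have h1 := (h r (by simpa using hr')).summable.tendsto_atTop_zero.norm
      simp only [norm_mul, norm_pow, norm_zero, Complex.norm_real, NNReal.norm_eq] at h1
      simpa [FormalMultilinearSeries.ofScalars_norm] using h1
    · intro y hy
      have hy' : ‖y‖ < 1 := by
        have h2 : ‖y‖ₑ < 1 := by simpa using hy
        rwa [← ofReal_norm, ENNReal.ofReal_lt_one] at h2
      have := h y hy'
      simpa [FormalMultilinearSeries.ofScalars_apply_eq, mul_comm (y ^ _)] using this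
  have h0 := hp.hasFPowerSeriesAt.eq_zero
  have h1 : (FormalMultilinearSeries.ofScalars ℂ a).coeff n = 0 := by rw [h0]; rfl
  simpa using h1

theorem evalCLM_injective : Function.Injective evalCLM := by
  rw [injective_iff_map_eq_zero]
  intro f hf
  have hs : ∀ z w : ℂ, ‖z‖ < 1 → ‖w‖ < 1 →
      HasSum (fun p : ℕ × ℕ => coeff f p * z ^ p.1 * w ^ p.2) 0 := by
    intro z w hz hw
    have := hasSum_evalCLM f ⟨(z, w), by simpa [bidisk] using ⟨hz, hw⟩⟩
    simpa [hf] using this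
  have hn : ∀ m : ℕ, ∀ w : ℂ, ‖w‖ < 1 → Summable (fun n : ℕ => coeff f (m, n) * w ^ n) := by
    intro m w hw
    have h1 := (hs (1 / 2) w (by norm_num) hw).summable.prod_factor m
    refine (h1.mul_left ((2 : ℂ) ^ m)).congr fun n => ?_
    have : (2 : ℂ) ^ m * (1 / 2) ^ m = 1 := by rw [← mul_pow]; norm_num
    linear_combination (coeff f (m, n) * w ^ n) * this
  refine ext_coeff fun p => ?_
  obtain ⟨m, n⟩ := p
  refine eq_zero_of_hasSum (fun n => coeff f (m, n)) (fun w hw => ?_) n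
  have h0 := eq_zero_of_hasSum (fun m => ∑' n : ℕ, coeff f (m, n) * w ^ n) (fun z hz => ?_) m
  · rw [← h0]
    exact (hn m w hw).hasSum
  · refine (hs z w hz hw).prod_fiberwise fun k => ?_
    have := (hn k w hw).hasSum.mul_right (z ^ k)
    refine hasSum_of_eq (fun j => ?_) this
    ring

/-- The Hardy space is a Hilbert space of functions on the bidisk. -/
noncomputable instance : RKHS ℂ HardySpace bidisk ℂ where
  coeCLM := evalCLM
  coeCLM_injective := evalCLM_injective

theorem hasSum_apply (f : HardySpace) (z : bidisk) :
    HasSum (fun p : ℕ × ℕ => coeff f p * z.1.1 ^ p.1 * z.1.2 ^ p.2) (f z) :=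
  hasSum_evalCLM f z

/-- A subspace of the Hardy space is a Hilbert space of functions on the bidisk. -/
noncomputable instance (S : Submodule ℂ HardySpace) : RKHS ℂ S bidisk ℂ where
  coeCLM := evalCLM ∘L S.subtypeL
  coeCLM_injective := evalCLM_injective.comp Subtype.val_injective

theorem coe_apply (S : Submodule ℂ HardySpace) (f : S) (z : bidisk) :
    f z = (f : HardySpace) z := rfl

/-- Pushing coefficients forward along an injective map of indices, filling in zeros. -/
theorem memlp_extend {e : ℕ × ℕ → ℕ × ℕ} (he : Function.Injective e) (f : HardySpace) :
    Memℓp (Function.extend e (coeff f) 0) 2 := by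
  rw [memlp_iff]
  have h := (hasSum_extend_zero he).mpr (hasSum_norm_sq f)
  refine h.summable.congr fun p => ?_
  by_cases hp : ∃ q, e q = p
  · obtain ⟨q, rfl⟩ := hp
    simp [he.extend_apply]
  · simp [Function.extend_apply' _ _ _ hp]

/-- The isometry of the Hardy space given by an injective map of indices. -/
noncomputable def shift (e : ℕ × ℕ → ℕ × ℕ) (he : Function.Injective e) :
    HardySpace →ₗᵢ[ℂ] HardySpace where
  toFun f := ofCoeff (Function.extend e (coeff f) 0) (memlp_extend he f)
  map_add' f g := by
    refine ext_coeff fun p => ?_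
    rw [coeff_add]
    simp only [coeff_ofCoeff]
    by_cases hp : ∃ q, e q = p
    · obtain ⟨q, rfl⟩ := hp
      simp [he.extend_apply, coeff_add]
    · simp [Function.extend_apply' _ _ _ hp]
  map_smul' c f := by
    refine ext_coeff fun p => ?_
    simp only [RingHom.id_apply]
    rw [coeff_smul]
    simp only [coeff_ofCoeff]
    by_cases hp : ∃ q, e q = p
    · obtain ⟨q, rfl⟩ := hp
      simp [he.extend_apply, coeff_smul]
    · simp [Function.extend_apply' _ _ _ hp]
  norm_map' f := by
    have h1 := hasSum_norm_sq (ofCoeff (Function.extend e (coeff f) 0) (memlp_extend he f))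
    have h2 := (hasSum_extend_zero he).mpr (hasSum_norm_sq f)
    have h3 : (fun p => ‖coeff (ofCoeff (Function.extend e (coeff f) 0) (memlp_extend he f)) p‖ ^ 2)
        = Function.extend e (fun p => ‖coeff f p‖ ^ 2) 0 := by
      funext p
      simp only [coeff_ofCoeff]
      by_cases hp : ∃ q, e q = p
      · obtain ⟨q, rfl⟩ := hp
        simp [he.extend_apply]
      · simp [Function.extend_apply' _ _ _ hp]
    rw [h3] at h1
    have h4 := h1.unique h2
    exact (sq_eq_sq₀ (norm_nonneg _) (norm_nonneg _)).mp h4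

theorem hasSum_shift {e : ℕ × ℕ → ℕ × ℕ} (he : Function.Injective e) (f : HardySpace)
    (z : bidisk) :
    HasSum (fun p : ℕ × ℕ => coeff f p * z.1.1 ^ (e p).1 * z.1.2 ^ (e p).2)
      (shift e he f z) := by
  have h := hasSum_apply (shift e he f) z
  refine hasSum_of_eq (fun p => ?_) ((he.hasSum_iff fun p hp => ?_).mpr h)
  · simp [shift, coeff_ofCoeff, he.extend_apply]
  · have hp' : ¬ ∃ q, e q = p := fun ⟨q, hq⟩ => hp ⟨q, hq⟩
    simp [shift, coeff_ofCoeff, Function.extend_apply' _ _ _ hp']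

/-- Multiplication by the first variable `z₁`. -/
noncomputable def M₁ : HardySpace →L[ℂ] HardySpace :=
  (shift (fun p => (p.1 + 1, p.2)) fun p q h => by
    simpa [Prod.ext_iff] using h).toContinuousLinearMap

/-- Multiplication by the second variable `z₂`. -/
noncomputable def M₂ : HardySpace →L[ℂ] HardySpace :=
  (shift (fun p => (p.1, p.2 + 1)) fun p q h => by
    simpa [Prod.ext_iff] using h).toContinuousLinearMap

theorem M₁_apply (f : HardySpace) (z : bidisk) : M₁ f z = z.1.1 * f z := by
  have h1 := hasSum_shift (e := fun p => (p.1 + 1, p.2)) (fun p q h => by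
    simpa [Prod.ext_iff] using h) f z
  refine h1.unique (hasSum_of_eq (fun p => ?_) ((hasSum_apply f z).mul_left z.1.1))
  ring

theorem M₂_apply (f : HardySpace) (z : bidisk) : M₂ f z = z.1.2 * f z := by
  have h1 := hasSum_shift (e := fun p => (p.1, p.2 + 1)) (fun p q h => by
    simpa [Prod.ext_iff] using h) f z
  refine h1.unique (hasSum_of_eq (fun p => ?_) ((hasSum_apply f z).mul_left z.1.2))
  ring

end HardySpace

open HardySpace

/-- The subspace `φ H²` of the Hardy space. -/
noncomputable def phiHardy (φ : ℂ × ℂ → ℂ) : Submodule ℂ HardySpace where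
  carrier := {h | ∃ f : HardySpace, ∀ z : bidisk, h z = φ z * f z}
  add_mem' := by
    rintro _ _ ⟨f, hf⟩ ⟨g, hg⟩
    exact ⟨f + g, fun z => by simp [hf, hg, mul_add]⟩
  zero_mem' := ⟨0, fun z => by simp⟩
  smul_mem' := by
    rintro c _ ⟨f, hf⟩
    exact ⟨c • f, fun z => by simp [hf]; ring⟩

/-- The model space `H² ⊖ φ H²`. -/
noncomputable def modelSpace (φ : ℂ × ℂ → ℂ) : Submodule ℂ HardySpace := (phiHardy φ)ᗮ

/-- The maximal subspace of the model space that is invariant under multiplication by `z₁`. -/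
noncomputable def S1max (φ : ℂ × ℂ → ℂ) : Submodule ℂ HardySpace :=
  sSup {S | S ≤ modelSpace φ ∧ ∀ f ∈ S, M₁ f ∈ S}

theorem isGreatest_S1max (φ : ℂ × ℂ → ℂ) :
    IsGreatest {S : Submodule ℂ HardySpace | S ≤ modelSpace φ ∧ ∀ f ∈ S, M₁ f ∈ S}
      (S1max φ) := by
  refine ⟨⟨sSup_le fun S hS => hS.1, ?_⟩, fun S hS => le_sSup hS⟩
  have h : S1max φ ≤ (S1max φ).comap M₁.toLinearMap :=
    sSup_le fun S hS f hf =>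
      (le_sSup (α := Submodule ℂ HardySpace) hS : S ≤ S1max φ) (hS.2 f hf)
  exact fun f hf => h hf

theorem isClosed_S1max (φ : ℂ × ℂ → ℂ) : IsClosed (S1max φ : Set HardySpace) := by
  have h : (S1max φ).topologicalClosure ≤ S1max φ := by
    refine (isGreatest_S1max φ).2 ⟨?_, fun f hf => ?_⟩
    · exact Submodule.topologicalClosure_minimal _ (isGreatest_S1max φ).1.1
        (Submodule.isClosed_orthogonal _)
    · exact map_mem_closure M₁.continuous hf (isGreatest_S1max φ).1.2
  have h2 : (S1max φ).topologicalClosure = S1max φ :=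
    le_antisymm h (Submodule.le_topologicalClosure _)
  rw [← h2]
  exact Submodule.isClosed_topologicalClosure _

/-- The orthogonal complement of `S1max φ` in the model space. -/
noncomputable def S2min (φ : ℂ × ℂ → ℂ) : Submodule ℂ HardySpace :=
  modelSpace φ ⊓ (S1max φ)ᗮ

/-- The Hilbert space `S1max φ ⊖ z₁ S1max φ`. -/
noncomputable def HK1max (φ : ℂ × ℂ → ℂ) : Submodule ℂ HardySpace :=
  S1max φ ⊓ ((S1max φ).map M₁.toLinearMap)ᗮ

/-- The Hilbert space `S2min φ ⊖ z₂ S2min φ`. -/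
noncomputable def HK2min (φ : ℂ × ℂ → ℂ) : Submodule ℂ HardySpace :=
  S2min φ ⊓ ((S2min φ).map M₂.toLinearMap)ᗮ

instance (φ : ℂ × ℂ → ℂ) : CompleteSpace (HK1max φ) :=
  IsClosed.completeSpace_coe (hs :=
    (isClosed_S1max φ).inter (Submodule.isClosed_orthogonal _))

instance (φ : ℂ × ℂ → ℂ) : CompleteSpace (HK2min φ) :=
  IsClosed.completeSpace_coe (hs :=
    ((Submodule.isClosed_orthogonal _).inter (Submodule.isClosed_orthogonal _)).inter
      (Submodule.isClosed_orthogonal _))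

/-- The kernel function `K₁max(·, w)` of the Hilbert function space `HK1max φ`. -/
noncomputable def k1max (φ : ℂ × ℂ → ℂ) (w : bidisk) : HK1max φ :=
  RKHS.kerFun (HK1max φ) w 1

/-- The kernel function `K₂min(·, w)` of the Hilbert function space `HK2min φ`. -/
noncomputable def k2min (φ : ℂ × ℂ → ℂ) (w : bidisk) : HK2min φ :=
  RKHS.kerFun (HK2min φ) w 1

/-- The orthogonal projection of the Hardy space onto `HK1max φ`. -/
noncomputable def P₁ (φ : ℂ × ℂ → ℂ) : HardySpace →L[ℂ] HK1max φ :=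
  (HK1max φ).orthogonalProjectionOnto

/-- The orthogonal projection of the Hardy space onto `HK2min φ`. -/
noncomputable def P₂ (φ : ℂ × ℂ → ℂ) : HardySpace →L[ℂ] HK2min φ :=
  (HK2min φ).orthogonalProjectionOnto

/-- The state space: the orthogonal direct sum of `HK2min φ` and `HK1max φ`. -/
abbrev StateSpace (φ : ℂ × ℂ → ℂ) : Type := WithLp 2 (HK2min φ × HK1max φ)

/-- The pair `(f₁, f₂)` as an element of the state space. -/
noncomputable def statePair (φ : ℂ × ℂ → ℂ) (f₁ : HK2min φ) (f₂ : HK1max φ) : StateSpace φ :=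
  WithLp.toLp 2 (f₁, f₂)

/-- The orthogonal direct sum of `ℂ` and the state space. -/
abbrev ColligationSpace (φ : ℂ × ℂ → ℂ) : Type := WithLp 2 (ℂ × StateSpace φ)

/-- `V` is an isometry of `ℂ ⊕ HK2min φ ⊕ HK1max φ` that sends
`(1, conj w₁ k₂, conj w₂ k₁)` to `(conj φ(w), k₂, k₁)` for every `w` in the bidisk, where
`k₂ = K₂min(·, w)` and `k₁ = K₁max(·, w)`. -/
def IsModelIsometry (φ : ℂ × ℂ → ℂ) (V : ColligationSpace φ →ₗᵢ[ℂ] ColligationSpace φ) : Prop :=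
  ∀ w : bidisk,
    V (WithLp.toLp 2 (1, statePair φ (conj w.1.1 • k2min φ w) (conj w.1.2 • k1max φ w))) =
      WithLp.toLp 2 (conj (φ w), statePair φ (k2min φ w) (k1max φ w))

/-- The lower right block `D` of the adjoint of `V`, written as a block operator
`(A, B; C, D)` on `ℂ ⊕ StateSpace φ`. -/
noncomputable def blockD (φ : ℂ × ℂ → ℂ) (V : ColligationSpace φ →ₗᵢ[ℂ] ColligationSpace φ)
    (f : StateSpace φ) : StateSpace φ :=
  (ContinuousLinearMap.adjoint V.toContinuousLinearMap (WithLp.toLp 2 (0, f))).snd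

/-! Since `|φ| = 1` almost everywhere on the torus, the products `z^p Φ` of `Φ` (the element of `H²`
with values `φ`) with the monomials are orthonormal (`IsInnerFunction.orthonormal`). Hence
multiplication by `φ` is an isometry of `H²` with range `φ H²`, and the model space has kernel `(1 -
φ(v) conj φ(w)) s_w(v)`, where `s_w` is the Szegő kernel. All the geometry below uses only this
orthonormality.

An `f` in the model space lies in `S1max φ` exactly when every `z₁^(j+1) f` is orthogonal to every
`z₂^k Φ` (`mem_S1max_iff`). Passing to adjoints, `S2min φ` is the closed span of the vectors
`M₁*^(j+1) z₂^k Φ`, which is invariant under `z₂` because `z₂` commutes with `M₁*`. For a closed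
subspace `S` invariant under `z_j`, the kernel of `S ⊖ z_j S` is `1 - v_j conj w_j` times the kernel
of `S`. Adding the kernels of `S1max φ` and `S2min φ` therefore gives the Agler decomposition of `1
- φ(v) conj φ(w)`.

That identity says that the input and output vectors have the same Gram matrix, which yields `V` on
the span of the inputs. The inputs are total: orthogonality of `(a, f₂, f₁)` to all of them means `a
+ z₁ f₂ + z₂ f₁ = 0`, which forces `f₁ ∈ z₁ S1max φ`, hence `f₁ = 0`, and then everything vanishes
(`eq_zero_of_inner_inputVector`). So `V` is everywhere defined and unique.

For the formula, `V* V = 1` sends outputs back to inputs, and totality identifies `V* (1, 0)` as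
`(Φ(0), F)`. The identity needed for this is `φ = Φ(0) + z₁ F₂ + z₂ F₁` (`M₁_add_M₂_projections`).
-/

namespace HardySpace

/-! ### Monomial shifts of the Hardy space and their adjoints. -/

theorem coeff_sub (f g : HardySpace) (p : ℕ × ℕ) :
    coeff (f - g) p = coeff f p - coeff g p := rfl

theorem coeff_shift {e : ℕ × ℕ → ℕ × ℕ} (he : Function.Injective e) (f : HardySpace)
    (q : ℕ × ℕ) : coeff (shift e he f) (e q) = coeff f q :=
  he.extend_apply _ _ _

theorem coeff_shift_of_notMem {e : ℕ × ℕ → ℕ × ℕ} (he : Function.Injective e) (f : HardySpace)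
    {r : ℕ × ℕ} (hr : ¬ ∃ q, e q = r) : coeff (shift e he f) r = 0 :=
  Function.extend_apply' _ _ _ hr

/-- The monomial `z₁ ^ q.1 * z₂ ^ q.2`. -/
noncomputable def monomial (q : ℕ × ℕ) : HardySpace :=
  ofCoeff (Pi.single q 1) (by
    rw [memlp_iff]
    refine summable_of_ne_finset_zero (s := {q}) fun p hp => ?_
    rw [Pi.single_eq_of_ne (by simpa using hp)]
    simp)

theorem coeff_monomial (q p : ℕ × ℕ) : coeff (monomial q) p = if p = q then 1 else 0 := by
  simp [monomial, coeff_ofCoeff, Pi.single_apply]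

theorem inner_monomial_left (q : ℕ × ℕ) (f : HardySpace) : ⟪monomial q, f⟫_ℂ = coeff f q := by
  refine (hasSum_inner (monomial q) f).unique ?_
  have h := hasSum_ite_eq q (coeff f q)
  refine hasSum_of_eq (fun p => ?_) h
  rw [coeff_monomial]
  split_ifs with hp
  · simp [hp]
  · simp

theorem shift_monomial {e : ℕ × ℕ → ℕ × ℕ} (he : Function.Injective e) (q : ℕ × ℕ) :
    shift e he (monomial q) = monomial (e q) := by
  refine ext_coeff fun p => ?_
  by_cases hp : ∃ r, e r = p
  · obtain ⟨r, rfl⟩ := hp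
    rw [coeff_shift, coeff_monomial, coeff_monomial]
    simp [he.eq_iff]
  · rw [coeff_shift_of_notMem he _ hp, coeff_monomial, if_neg]
    rintro rfl
    exact hp ⟨q, rfl⟩

/-- Multiplication by the monomial `z₁ ^ p.1 * z₂ ^ p.2`. -/
noncomputable def monomialMul (p : ℕ × ℕ) : HardySpace →L[ℂ] HardySpace :=
  (shift (fun q => q + p) (add_left_injective p)).toContinuousLinearMap

theorem monomialMul_eq_shift (p : ℕ × ℕ) (f : HardySpace) :
    monomialMul p f = shift (fun q => q + p) (add_left_injective p) f := rfl

/-- The adjoint of multiplication by a monomial. -/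
noncomputable def backShift (p : ℕ × ℕ) : HardySpace →L[ℂ] HardySpace :=
  ContinuousLinearMap.adjoint (monomialMul p)

theorem M₁_eq : M₁ = monomialMul (1, 0) := rfl

theorem M₂_eq : M₂ = monomialMul (0, 1) := rfl

theorem inner_backShift_left (p : ℕ × ℕ) (f g : HardySpace) :
    ⟪backShift p f, g⟫_ℂ = ⟪f, monomialMul p g⟫_ℂ :=
  ContinuousLinearMap.adjoint_inner_left _ _ _

theorem inner_backShift_right (p : ℕ × ℕ) (f g : HardySpace) :
    ⟪f, backShift p g⟫_ℂ = ⟪monomialMul p f, g⟫_ℂ :=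
  ContinuousLinearMap.adjoint_inner_right _ _ _

theorem coeff_monomialMul (p : ℕ × ℕ) (f : HardySpace) (q : ℕ × ℕ) :
    coeff (monomialMul p f) q = if p ≤ q then coeff f (q - p) else 0 := by
  split_ifs with h
  · obtain ⟨r, rfl⟩ := exists_add_of_le h
    rw [add_comm p r, add_tsub_cancel_right]
    exact coeff_shift (add_left_injective p) f r
  · refine coeff_shift_of_notMem (add_left_injective p) f ?_
    rintro ⟨r, rfl⟩
    exact h le_add_self

theorem coeff_backShift (p : ℕ × ℕ) (f : HardySpace) (q : ℕ × ℕ) :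
    coeff (backShift p f) q = coeff f (q + p) := by
  rw [← inner_monomial_left, inner_backShift_right, monomialMul_eq_shift, shift_monomial,
    inner_monomial_left]

theorem monomialMul_monomial (p q : ℕ × ℕ) : monomialMul p (monomial q) = monomial (q + p) :=
  shift_monomial (add_left_injective p) q

theorem inner_monomialMul_monomialMul (p : ℕ × ℕ) (f g : HardySpace) :
    ⟪monomialMul p f, monomialMul p g⟫_ℂ = ⟪f, g⟫_ℂ :=
  (shift (fun q => q + p) (add_left_injective p)).inner_map_map f g

theorem backShift_monomialMul (p : ℕ × ℕ) (f : HardySpace) :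
    backShift p (monomialMul p f) = f :=
  ext_inner_left ℂ fun g => by rw [inner_backShift_right, inner_monomialMul_monomialMul]

theorem monomialMul_monomialMul (p q : ℕ × ℕ) (f : HardySpace) :
    monomialMul p (monomialMul q f) = monomialMul (p + q) f := by
  refine ext_inner_left ℂ fun g => ?_
  rw [← inner_backShift_left, ← inner_backShift_left, ← inner_backShift_left]
  congr 1
  refine ext_coeff fun r => ?_
  simp only [coeff_backShift]
  congr 1
  abel

theorem monomialMul_zero (f : HardySpace) : monomialMul (0, 0) f = f := by
  refine ext_coeff fun q => ?_
  rw [coeff_monomialMul, if_pos (show ((0, 0) : ℕ × ℕ) ≤ q from zero_le)]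
  rfl

theorem backShift_backShift (p q : ℕ × ℕ) (f : HardySpace) :
    backShift p (backShift q f) = backShift (p + q) f := by
  refine ext_coeff fun r => ?_
  simp only [coeff_backShift]
  congr 1
  abel

/-- Multiplication by `z₂` commutes with the adjoint of multiplication by `z₁`. -/
theorem monomialMul_backShift_comm (j k : ℕ) (f : HardySpace) :
    monomialMul (0, k) (backShift (j, 0) f) = backShift (j, 0) (monomialMul (0, k) f) := by
  refine ext_coeff fun r => ?_
  obtain ⟨m, n⟩ := r
  simp [coeff_monomialMul, coeff_backShift]

/-- Multiplication by `z₁` commutes with the adjoint of multiplication by `z₂`. -/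
theorem monomialMul_backShift_comm' (j k : ℕ) (f : HardySpace) :
    monomialMul (j, 0) (backShift (0, k) f) = backShift (0, k) (monomialMul (j, 0) f) := by
  refine ext_coeff fun r => ?_
  obtain ⟨m, n⟩ := r
  simp [coeff_monomialMul, coeff_backShift]

theorem monomialMul_apply (p : ℕ × ℕ) (f : HardySpace) (z : bidisk) :
    monomialMul p f z = z.1.1 ^ p.1 * z.1.2 ^ p.2 * f z := by
  refine (hasSum_shift (add_left_injective p) f z).unique
    (hasSum_of_eq (fun q => ?_) ((hasSum_apply f z).mul_left (z.1.1 ^ p.1 * z.1.2 ^ p.2)))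
  simp only [Prod.fst_add, Prod.snd_add, pow_add]
  ring

theorem inner_szego_left (w : bidisk) (f : HardySpace) : ⟪szego w, f⟫_ℂ = f w := rfl

theorem inner_szego_right (w : bidisk) (f : HardySpace) : ⟪f, szego w⟫_ℂ = conj (f w) := by
  rw [← inner_szego_left, inner_conj_symm]

theorem backShift_szego (p : ℕ × ℕ) (w : bidisk) :
    backShift p (szego w) = (conj w.1.1 ^ p.1 * conj w.1.2 ^ p.2) • szego w := by
  refine ext_inner_left ℂ fun f => ?_
  rw [inner_backShift_right, inner_smul_right, inner_szego_right, inner_szego_right,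
    monomialMul_apply]
  simp

/-- The kernel is a product of two geometric series. Clearing denominators makes the identity a
polynomial relation that `agler_decomposition` can use linearly. -/
theorem szego_apply (w z : bidisk) :
    (1 - z.1.1 * conj w.1.1) * (1 - z.1.2 * conj w.1.2) * szego w z = 1 := by
  have h1 : ‖z.1.1 * conj w.1.1‖ < 1 := by
    rw [norm_mul, RCLike.norm_conj]
    exact mul_lt_one_of_nonneg_of_lt_one_left (norm_nonneg _) (bidisk_fst z) (bidisk_fst w).le
  have h2 : ‖z.1.2 * conj w.1.2‖ < 1 := by
    rw [norm_mul, RCLike.norm_conj]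
    exact mul_lt_one_of_nonneg_of_lt_one_left (norm_nonneg _) (bidisk_snd z) (bidisk_snd w).le
  have h := (hasSum_geometric_of_norm_lt_one h1).mul (hasSum_geometric_of_norm_lt_one h2)
    (summable_mul_of_summable_norm (summable_norm_geometric_of_norm_lt_one h1)
      (summable_norm_geometric_of_norm_lt_one h2))
  have h3 : szego w z = (1 - z.1.1 * conj w.1.1)⁻¹ * (1 - z.1.2 * conj w.1.2)⁻¹ := by
    refine (hasSum_apply (szego w) z).unique (hasSum_of_eq (fun p => ?_) h)
    simp only [szego, coeff_ofCoeff, mul_pow]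
    ring
  have n1 : 1 - z.1.1 * conj w.1.1 ≠ 0 := fun h => by
    rw [← sub_eq_zero.mp h] at h1; simp at h1
  have n2 : 1 - z.1.2 * conj w.1.2 ≠ 0 := fun h => by
    rw [← sub_eq_zero.mp h] at h2; simp at h2
  rw [h3]
  field_simp

theorem monomial_apply (q : ℕ × ℕ) (z : bidisk) :
    monomial q z = z.1.1 ^ q.1 * z.1.2 ^ q.2 := by
  rw [← inner_szego_left, ← inner_conj_symm, inner_monomial_left]
  simp [szego, coeff_ofCoeff]

/-- Inclusion-exclusion: `(1 - z₁ M₁*)(1 - z₂ M₂*)` is the projection onto the constants. -/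
theorem eq_add_backShift (f : HardySpace) :
    monomialMul (1, 0) (backShift (1, 0) f) + monomialMul (0, 1) (backShift (0, 1) f) -
      monomialMul (1, 1) (backShift (1, 1) f) = f - coeff f 0 • monomial 0 := by
  refine ext_coeff fun r => ?_
  obtain ⟨m, n⟩ := r
  rcases m with _ | m <;> rcases n with _ | n <;>
    simp [coeff_sub, coeff_add, coeff_smul, coeff_monomial, coeff_monomialMul, coeff_backShift,
      Prod.ext_iff]
  exact (sub_self _).symm

end HardySpace

/-! ### Wandering subspaces and Gram matrices in Hilbert space. -/

section Abstract

variable {H : Type*} [NormedAddCommGroup H] [InnerProductSpace ℂ H]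

/-- The projection onto the wandering subspace `S ⊖ M S` of an isometry `M` leaving `S`
invariant. -/
theorem starProjection_wandering [CompleteSpace H] (M : H →L[ℂ] H)
    (hM : ∀ f g, ⟪M f, M g⟫_ℂ = ⟪f, g⟫_ℂ) (S : Submodule ℂ H) [S.HasOrthogonalProjection]
    (hS : ∀ f ∈ S, M f ∈ S) (E : Submodule ℂ H) [E.HasOrthogonalProjection]
    (hE : E = S ⊓ (S.map M.toLinearMap)ᗮ) (x : H) :
    E.starProjection x =
      S.starProjection x - M (S.starProjection (ContinuousLinearMap.adjoint M x)) := by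
  subst hE
  -- As `M` is isometric, `M P_S M*` is the projection onto `M S ≤ S`; subtracting it from `P_S`
  -- leaves the projection onto `S ⊖ M S`.
  refine Submodule.eq_starProjection_of_mem_of_inner_eq_zero
    ⟨S.sub_mem (S.starProjection_apply_mem x) (hS _ (S.starProjection_apply_mem _)), ?_⟩
    fun e he => ?_
  · rw [SetLike.mem_coe, Submodule.mem_orthogonal]
    rintro _ ⟨s, hs, rfl⟩
    have h1 : ⟪M s, S.starProjection x⟫_ℂ = ⟪M s, x⟫_ℂ := by
      rw [← S.inner_starProjection_left_eq_right,
        Submodule.starProjection_eq_self_iff.mpr (hS s hs)]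
    have h2 : ⟪s, S.starProjection (ContinuousLinearMap.adjoint M x)⟫_ℂ = ⟪M s, x⟫_ℂ := by
      rw [← S.inner_starProjection_left_eq_right, Submodule.starProjection_eq_self_iff.mpr hs,
        ContinuousLinearMap.adjoint_inner_right]
    simp only [ContinuousLinearMap.coe_coe]
    rw [inner_sub_right, hM, h1, h2, sub_self]
  · have h1 : ⟪x - S.starProjection x, e⟫_ℂ = 0 := S.starProjection_inner_eq_zero x e he.1
    have h2 : ⟪M (S.starProjection (ContinuousLinearMap.adjoint M x)), e⟫_ℂ = 0 :=
      he.2 _ ⟨_, S.starProjection_apply_mem _, rfl⟩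
    rw [← sub_add, inner_add_left, h1, h2, add_zero]

/-- Two families with the same Gram matrix, the first of which is total, are intertwined by a
unique isometry. -/
theorem existsUnique_linearIsometry {ι : Type*} [CompleteSpace H] (x y : ι → H)
    (hx : (Submodule.span ℂ (Set.range x))ᗮ = ⊥)
    (hxy : ∀ i j, ⟪x i, x j⟫_ℂ = ⟪y i, y j⟫_ℂ) :
    ∃! V : H →ₗᵢ[ℂ] H, ∀ i, V (x i) = y i := by
  have hdense : (Submodule.span ℂ (Set.range x)).topologicalClosure = ⊤ :=
    (Submodule.topologicalClosure_eq_top_iff).mpr hx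
  have hdense' : DenseRange (Finsupp.linearCombination ℂ x) := by
    have h := Submodule.dense_iff_topologicalClosure_eq_top.mpr hdense
    rw [← Finsupp.range_linearCombination] at h
    exact h
  have hinner : ∀ c : ι →₀ ℂ, ⟪Finsupp.linearCombination ℂ x c, Finsupp.linearCombination ℂ x c⟫_ℂ =
      ⟪Finsupp.linearCombination ℂ y c, Finsupp.linearCombination ℂ y c⟫_ℂ := fun c => by
    simp only [Finsupp.linearCombination_apply, Finsupp.sum, sum_inner, inner_sum,
      inner_smul_left, inner_smul_right, hxy]
  have hnorm : ∀ c : ι →₀ ℂ, ‖Finsupp.linearCombination ℂ y c‖ =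
      ‖Finsupp.linearCombination ℂ x c‖ := fun c => by
    rw [@norm_eq_sqrt_re_inner ℂ, @norm_eq_sqrt_re_inner ℂ _ _ _ _
      (Finsupp.linearCombination ℂ x c), hinner]
  have hbound : ∃ C : ℝ, ∀ c : ι →₀ ℂ, ‖Finsupp.linearCombination ℂ y c‖ ≤
      C * ‖Finsupp.linearCombination ℂ x c‖ := ⟨1, fun c => by rw [one_mul, hnorm]⟩
  -- Equal Gram matrices make the two linear combinations with the same coefficients equal in norm,
  -- so the map between them is well defined, isometric, and extends by density.
  set W : H →L[ℂ] H := (Finsupp.linearCombination ℂ y).extendOfNorm (Finsupp.linearCombination ℂ x)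
    with hW
  have hWx : ∀ c, W (Finsupp.linearCombination ℂ x c) = Finsupp.linearCombination ℂ y c :=
    LinearMap.extendOfNorm_eq hdense' hbound
  have hWnorm : ∀ v, ‖W v‖ = ‖v‖ := fun v => by
    refine hdense'.induction (P := fun v => ‖W v‖ = ‖v‖) ?_
      (isClosed_eq (by fun_prop) (by fun_prop)) v
    rintro _ ⟨c, rfl⟩
    rw [hWx, hnorm]
  refine ⟨⟨W.toLinearMap, hWnorm⟩, fun i => ?_, fun V hV => ?_⟩
  · have h := hWx (Finsupp.single i 1)
    simpa using h
  · have h : V.toContinuousLinearMap = W :=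
      ContinuousLinearMap.ext_on (Submodule.dense_iff_topologicalClosure_eq_top.mpr hdense) (by
        rintro _ ⟨i, rfl⟩
        have h := hWx (Finsupp.single i 1)
        simp only [Finsupp.linearCombination_single, one_smul] at h
        rw [h]
        exact hV i)
    ext v
    exact congrArg (fun T : H →L[ℂ] H => T v) h

end Abstract

/-! ### The model space, `S1max φ` and generators of `S2min φ`. -/

section ModelSpace

variable {φ : ℂ × ℂ → ℂ} {Φ : HardySpace}

/-- The isometry sending the monomials to the orthonormal family of products of `Φ` with
monomials. -/
noncomputable def mulIsometry (hon : Orthonormal ℂ fun p => monomialMul p Φ) :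
    HardySpace →ₗᵢ[ℂ] HardySpace :=
  hon.orthogonalFamily.linearIsometry

theorem hasSum_mulIsometry (hon : Orthonormal ℂ fun p => monomialMul p Φ) (f : HardySpace) :
    HasSum (fun p => coeff f p • monomialMul p Φ) (mulIsometry hon f) :=
  hon.orthogonalFamily.hasSum_linearIsometry f

theorem mulIsometry_apply (hon : Orthonormal ℂ fun p => monomialMul p Φ)
    (hΦ : ∀ z : bidisk, Φ z = φ z) (f : HardySpace) (z : bidisk) :
    mulIsometry hon f z = φ z * f z := by
  have h := (hasSum_mulIsometry hon f).mapL (innerSL ℂ (szego z))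
  refine h.unique (hasSum_of_eq (fun p => ?_) ((hasSum_apply f z).mul_left (φ z)))
  simp only [innerSL_apply_apply, inner_smul_right, inner_szego_left, monomialMul_apply, hΦ]
  ring

theorem mulIsometry_mem (hon : Orthonormal ℂ fun p => monomialMul p Φ)
    (hΦ : ∀ z : bidisk, Φ z = φ z) (f : HardySpace) : mulIsometry hon f ∈ phiHardy φ :=
  ⟨f, mulIsometry_apply hon hΦ f⟩

theorem exists_mulIsometry_eq (hon : Orthonormal ℂ fun p => monomialMul p Φ)
    (hΦ : ∀ z : bidisk, Φ z = φ z) {h : HardySpace} (hh : h ∈ phiHardy φ) :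
    ∃ f, mulIsometry hon f = h := by
  obtain ⟨f, hf⟩ := hh
  refine ⟨f, RKHS.ext (𝕜 := ℂ) fun z => ?_⟩
  rw [mulIsometry_apply hon hΦ, hf]

theorem monomialMul_mem_phiHardy (hΦ : ∀ z : bidisk, Φ z = φ z) (p : ℕ × ℕ) :
    monomialMul p Φ ∈ phiHardy φ :=
  ⟨monomial p, fun z => by rw [monomialMul_apply, monomial_apply, hΦ, mul_comm]⟩

/-- Every element of `φ H²` is a convergent sum of multiples of the `z^p Φ`, so orthogonality need
only be tested on these. -/
theorem mem_modelSpace_iff (hon : Orthonormal ℂ fun p => monomialMul p Φ)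
    (hΦ : ∀ z : bidisk, Φ z = φ z) {f : HardySpace} :
    f ∈ modelSpace φ ↔ ∀ p, ⟪f, monomialMul p Φ⟫_ℂ = 0 := by
  rw [modelSpace, Submodule.mem_orthogonal']
  refine ⟨fun h p => h _ (monomialMul_mem_phiHardy hΦ p), fun h g hg => ?_⟩
  obtain ⟨g, rfl⟩ := exists_mulIsometry_eq hon hΦ hg
  refine ((hasSum_mulIsometry hon g).mapL (innerSL ℂ f)).unique
    (hasSum_of_eq (fun p => ?_) (hasSum_zero))
  rw [innerSL_apply_apply, inner_smul_right, h, mul_zero]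

instance : CompleteSpace (S1max φ) := (isClosed_S1max φ).completeSpace_coe

instance : CompleteSpace (S2min φ) :=
  IsClosed.completeSpace_coe (hs :=
    (Submodule.isClosed_orthogonal _).inter (Submodule.isClosed_orthogonal _))

instance : (modelSpace φ).HasOrthogonalProjection :=
  inferInstanceAs ((phiHardy φ)ᗮ.HasOrthogonalProjection)

/-- If `T` is multiplication by `φ`, then `T*` multiplies the Szegő kernel at `w` by `conj φ(w)`,
and `T T*` is the projection onto `φ H²`. -/
theorem starProjection_modelSpace_szego (hon : Orthonormal ℂ fun p => monomialMul p Φ)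
    (hΦ : ∀ z : bidisk, Φ z = φ z) (w : bidisk) :
    (modelSpace φ).starProjection (szego w) =
      szego w - conj (φ w) • mulIsometry hon (szego w) := by
  refine Submodule.eq_starProjection_of_mem_of_inner_eq_zero ?_ fun e he => ?_
  · rw [modelSpace, Submodule.mem_orthogonal]
    intro g hg
    obtain ⟨g, rfl⟩ := exists_mulIsometry_eq hon hΦ hg
    rw [inner_sub_right, inner_smul_right, LinearIsometry.inner_map_map, inner_szego_right,
      inner_szego_right, mulIsometry_apply hon hΦ, map_mul, sub_self]
  · rw [sub_sub_cancel]
    exact he _ (Submodule.smul_mem _ _ (mulIsometry_mem hon hΦ _))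

theorem S1max_le_modelSpace : S1max φ ≤ modelSpace φ := (isGreatest_S1max φ).1.1

theorem M₁_mem_S1max {f : HardySpace} (hf : f ∈ S1max φ) : M₁ f ∈ S1max φ :=
  (isGreatest_S1max φ).1.2 f hf

theorem monomialMul_mem_S1max {f : HardySpace} (hf : f ∈ S1max φ) (n : ℕ) :
    monomialMul (n, 0) f ∈ S1max φ := by
  induction n with
  | zero => rwa [monomialMul_zero]
  | succ n ih =>
    have h := M₁_mem_S1max ih
    rwa [M₁_eq, monomialMul_monomialMul, Prod.mk_add_mk, add_comm 1 n, add_zero] at h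

theorem starProjection_S2min (x : HardySpace) :
    (S2min φ).starProjection x =
      (modelSpace φ).starProjection x - (S1max φ).starProjection x := by
  refine Submodule.eq_starProjection_of_mem_of_inner_eq_zero ⟨?_, ?_⟩ fun e he => ?_
  · exact Submodule.sub_mem _ (Submodule.starProjection_apply_mem _ _)
      (S1max_le_modelSpace (Submodule.starProjection_apply_mem _ _))
  · rw [SetLike.mem_coe, Submodule.mem_orthogonal]
    intro s hs
    rw [inner_sub_right, ← Submodule.inner_starProjection_left_eq_right,
      ← Submodule.inner_starProjection_left_eq_right, Submodule.starProjection_eq_self_iff.mpr hs,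
      Submodule.starProjection_eq_self_iff.mpr (S1max_le_modelSpace hs), sub_self]
  · rw [← sub_add, inner_add_left, Submodule.starProjection_inner_eq_zero _ _ he.1, zero_add]
    exact he.2 _ (Submodule.starProjection_apply_mem _ _)

/-- The functions `z₂ ^ k M₁* ^ (j + 1) Φ`, whose closed span is `S2min φ`. -/
noncomputable def S2gen (Φ : HardySpace) (p : ℕ × ℕ) : HardySpace :=
  -- The exponent of `M₁*` starts at one: with exponent zero the vector would lie in `φ H²`, not in
  -- its complement.
  backShift (p.1 + 1, 0) (monomialMul (0, p.2) Φ)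

theorem inner_S2gen (f : HardySpace) (p : ℕ × ℕ) :
    ⟪f, S2gen Φ p⟫_ℂ = ⟪monomialMul (p.1 + 1, 0) f, monomialMul (0, p.2) Φ⟫_ℂ :=
  inner_backShift_right _ _ _

theorem M₂_S2gen (p : ℕ × ℕ) : M₂ (S2gen Φ p) = S2gen Φ (p.1, p.2 + 1) := by
  rw [S2gen, S2gen, M₂_eq, monomialMul_backShift_comm, monomialMul_monomialMul]
  simp [add_comm]

theorem inner_monomialMul_of_ne (hon : Orthonormal ℂ fun p => monomialMul p Φ) {p q : ℕ × ℕ}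
    (h : p ≠ q) : ⟪monomialMul p Φ, monomialMul q Φ⟫_ℂ = 0 := hon.2 h

theorem S2gen_mem_modelSpace (hon : Orthonormal ℂ fun p => monomialMul p Φ)
    (hΦ : ∀ z : bidisk, Φ z = φ z) (p : ℕ × ℕ) : S2gen Φ p ∈ modelSpace φ := by
  refine (mem_modelSpace_iff hon hΦ).mpr fun q => ?_
  rw [S2gen, inner_backShift_left, monomialMul_monomialMul]
  exact inner_monomialMul_of_ne hon fun h => by simp [Prod.ext_iff] at h; lia

/-- The conditions on the right say that all `z₁^j f` stay in the model space; they define a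
subspace invariant under `z₁`, which maximality puts inside `S1max φ`. -/
theorem mem_S1max_iff (hon : Orthonormal ℂ fun p => monomialMul p Φ)
    (hΦ : ∀ z : bidisk, Φ z = φ z) {f : HardySpace} :
    f ∈ S1max φ ↔ f ∈ modelSpace φ ∧ ∀ p, ⟪f, S2gen Φ p⟫_ℂ = 0 := by
  constructor
  · refine fun hf => ⟨S1max_le_modelSpace hf, fun p => ?_⟩
    rw [inner_S2gen]
    exact (mem_modelSpace_iff hon hΦ).mp (S1max_le_modelSpace (monomialMul_mem_S1max hf _)) _
  · let N : Submodule ℂ HardySpace :=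
      modelSpace φ ⊓ (Submodule.span ℂ (Set.range (S2gen Φ)))ᗮ
    have hN : ∀ g, g ∈ N ↔ g ∈ modelSpace φ ∧ ∀ p, ⟪g, S2gen Φ p⟫_ℂ = 0 := fun g => by
      refine and_congr_right fun _ => ?_
      rw [SetLike.mem_coe, Submodule.mem_orthogonal']
      refine ⟨fun h p => h _ (Submodule.subset_span ⟨p, rfl⟩), fun h u hu => ?_⟩
      induction hu using Submodule.span_induction with
      | mem x hx => obtain ⟨p, rfl⟩ := hx; exact h p
      | zero => exact inner_zero_right _
      | add x y _ _ hx hy => rw [inner_add_right, hx, hy, add_zero]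
      | smul c x _ hx => rw [inner_smul_right, hx, mul_zero]
    rw [← hN]
    suffices hN' : N ≤ S1max φ from fun hf => hN' hf
    refine (isGreatest_S1max φ).2 ⟨inf_le_left, fun g hg => ?_⟩
    obtain ⟨h1, h2⟩ := (hN g).mp hg
    refine (hN _).mpr ⟨(mem_modelSpace_iff hon hΦ).mpr fun p => ?_, fun p => ?_⟩
    -- Testing `z₁ g` against `z₁^m z₂^n Φ`: for `m = 0` this is the generator condition on `g`; for
    -- `m > 0` a factor `z₁` cancels on both sides.
    · obtain ⟨m, n⟩ := p
      rcases m with _ | m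
      · have := h2 (0, n)
        rwa [inner_S2gen] at this
      · have := (mem_modelSpace_iff hon hΦ).mp h1 (m, n)
        rw [M₁_eq, show ((m + 1, n) : ℕ × ℕ) = (1, 0) + (m, n) by simp [add_comm],
          ← monomialMul_monomialMul, inner_monomialMul_monomialMul, this]
    · have := h2 (p.1 + 1, p.2)
      rw [inner_S2gen] at this ⊢
      rw [M₁_eq, monomialMul_monomialMul]
      simpa using this

theorem S2gen_mem_S2min (hon : Orthonormal ℂ fun p => monomialMul p Φ)
    (hΦ : ∀ z : bidisk, Φ z = φ z) (p : ℕ × ℕ) : S2gen Φ p ∈ S2min φ :=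
  ⟨S2gen_mem_modelSpace hon hΦ p, fun _ hf => ((mem_S1max_iff hon hΦ).mp hf).2 p⟩

theorem S2min_eq (hon : Orthonormal ℂ fun p => monomialMul p Φ)
    (hΦ : ∀ z : bidisk, Φ z = φ z) :
    S2min φ = (Submodule.span ℂ (Set.range (S2gen Φ))).topologicalClosure := by
  refine le_antisymm ?_ (Submodule.topologicalClosure_minimal _ ?_ ?_)
  · intro f hf
    rw [← Submodule.orthogonal_orthogonal_eq_closure, ← Submodule.starProjection_eq_self_iff]
    set L := (Submodule.span ℂ (Set.range (S2gen Φ)))ᗮ with hL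
    rw [Submodule.starProjection_orthogonal_val, sub_eq_self]
    have hle : Lᗮ ≤ modelSpace φ := by
      rw [hL, Submodule.orthogonal_orthogonal_eq_closure]
      refine Submodule.topologicalClosure_minimal _ (Submodule.span_le.mpr ?_)
        (Submodule.isClosed_orthogonal _)
      rintro _ ⟨p, rfl⟩
      exact S2gen_mem_modelSpace hon hΦ p
    -- The component `u` of `f` orthogonal to the generators lies in `S1max φ`, while `f` is
    -- orthogonal to `S1max φ`; hence `‖u‖² = ⟪u, f⟫ = 0`.
    have hu : L.starProjection f ∈ S1max φ := by
      refine (mem_S1max_iff hon hΦ).mpr ⟨?_, fun p => ?_⟩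
      · have h1 : f - L.starProjection f ∈ modelSpace φ :=
          hle (Submodule.sub_starProjection_mem_orthogonal f)
        have h2 := Submodule.sub_mem _ hf.1 h1
        rwa [sub_sub_cancel] at h2
      · exact (Submodule.mem_orthogonal' _ _).mp (L.starProjection_apply_mem f) _
          (Submodule.subset_span ⟨p, rfl⟩)
    have h0 : ⟪L.starProjection f, f⟫_ℂ = 0 := hf.2 _ hu
    rw [← inner_self_eq_zero (𝕜 := ℂ), ← h0]
    conv_rhs => rw [← Submodule.starProjection_eq_self_iff.mpr (L.starProjection_apply_mem f)]
    exact (L.inner_starProjection_left_eq_right _ _).symm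
  · refine Submodule.span_le.mpr ?_
    rintro _ ⟨p, rfl⟩
    exact S2gen_mem_S2min hon hΦ p
  · exact (Submodule.isClosed_orthogonal _).inter (Submodule.isClosed_orthogonal _)

/-- `M₂` maps each generator to another generator, and `S2min φ` is closed. -/
theorem M₂_mem_S2min (hon : Orthonormal ℂ fun p => monomialMul p Φ)
    (hΦ : ∀ z : bidisk, Φ z = φ z) {f : HardySpace} (hf : f ∈ S2min φ) : M₂ f ∈ S2min φ := by
  have h : S2min φ ≤ (S2min φ).comap M₂.toLinearMap := by
    conv_lhs => rw [S2min_eq hon hΦ]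
    refine Submodule.topologicalClosure_minimal _ (Submodule.span_le.mpr ?_) ?_
    · rintro _ ⟨p, rfl⟩
      change M₂ (S2gen Φ p) ∈ S2min φ
      rw [M₂_S2gen]
      exact S2gen_mem_S2min hon hΦ _
    · exact ((Submodule.isClosed_orthogonal (phiHardy φ)).inter
        (Submodule.isClosed_orthogonal (S1max φ))).preimage M₂.continuous
  exact h hf

/-- After moving adjoints across, each inner product pairs two `z^p Φ` with different exponents. -/
theorem backShift_snd_mem_S1max (hon : Orthonormal ℂ fun p => monomialMul p Φ)
    (hΦ : ∀ z : bidisk, Φ z = φ z) : backShift (0, 1) Φ ∈ S1max φ := by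
  refine (mem_S1max_iff hon hΦ).mpr ⟨(mem_modelSpace_iff hon hΦ).mpr fun p => ?_, fun p => ?_⟩
  · rw [inner_backShift_left, monomialMul_monomialMul]
    nth_rewrite 1 [← monomialMul_zero Φ]
    exact inner_monomialMul_of_ne hon fun h => by simp [Prod.ext_iff] at h; lia
  · rw [S2gen, inner_backShift_left, monomialMul_backShift_comm, inner_backShift_right,
      monomialMul_monomialMul]
    exact inner_monomialMul_of_ne hon (by simp)

theorem coe_k1max (w : bidisk) : (k1max φ w : HardySpace) = (HK1max φ).starProjection (szego w) := by
  symm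
  refine Submodule.eq_starProjection_of_mem_of_inner_eq_zero (k1max φ w).2 fun e he => ?_
  have h := RKHS.kerFun_inner (𝕜 := ℂ) (H := HK1max φ) w 1 ⟨e, he⟩
  rw [inner_sub_left, inner_szego_left, sub_eq_zero]
  refine Eq.trans ?_ h.symm
  simp [coe_apply]

theorem coe_k2min (w : bidisk) : (k2min φ w : HardySpace) = (HK2min φ).starProjection (szego w) := by
  symm
  refine Submodule.eq_starProjection_of_mem_of_inner_eq_zero (k2min φ w).2 fun e he => ?_
  have h := RKHS.kerFun_inner (𝕜 := ℂ) (H := HK2min φ) w 1 ⟨e, he⟩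
  rw [inner_sub_left, inner_szego_left, sub_eq_zero]
  refine Eq.trans ?_ h.symm
  simp [coe_apply]

end ModelSpace

/-! ### The Agler decomposition, the isometry and its block `D`. -/

section Colligation

variable {φ : ℂ × ℂ → ℂ} {Φ : HardySpace}

theorem starProjection_HK1max (x : HardySpace) :
    (HK1max φ).starProjection x = (S1max φ).starProjection x -
      M₁ ((S1max φ).starProjection (backShift (1, 0) x)) :=
  starProjection_wandering M₁ (inner_monomialMul_monomialMul (1, 0)) _ (fun _ => M₁_mem_S1max)
    (HK1max φ) rfl x

theorem starProjection_HK2min (hon : Orthonormal ℂ fun p => monomialMul p Φ)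
    (hΦ : ∀ z : bidisk, Φ z = φ z) (x : HardySpace) :
    (HK2min φ).starProjection x = (S2min φ).starProjection x -
      M₂ ((S2min φ).starProjection (backShift (0, 1) x)) :=
  starProjection_wandering M₂ (inner_monomialMul_monomialMul (0, 1)) _
    (fun _ => M₂_mem_S2min hon hΦ) (HK2min φ) rfl x

/-- The wandering projection is applied to the Szegő kernel, an eigenvector of `M₁*` with eigenvalue
`conj w₁`. -/
theorem k1max_apply (w v : bidisk) :
    (k1max φ w) v =
      (1 - v.1.1 * conj w.1.1) * (S1max φ).starProjection (szego w) v := by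
  rw [coe_apply, coe_k1max, starProjection_HK1max, backShift_szego, map_smul, map_smul,
    RKHS.coe_sub, RKHS.coe_smul]
  simp only [Pi.sub_apply, Pi.smul_apply, M₁_apply, pow_one, pow_zero, mul_one, smul_eq_mul]
  ring

theorem k2min_apply (hon : Orthonormal ℂ fun p => monomialMul p Φ)
    (hΦ : ∀ z : bidisk, Φ z = φ z) (w v : bidisk) :
    (k2min φ w) v =
      (1 - v.1.2 * conj w.1.2) * (S2min φ).starProjection (szego w) v := by
  rw [coe_apply, coe_k2min, starProjection_HK2min hon hΦ, backShift_szego, map_smul, map_smul,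
    RKHS.coe_sub, RKHS.coe_smul]
  simp only [Pi.sub_apply, Pi.smul_apply, M₂_apply, pow_one, pow_zero, one_mul, smul_eq_mul]
  ring

/-- The Agler decomposition of `1 - φ(v) conj φ(w)`. -/
theorem agler_decomposition (hon : Orthonormal ℂ fun p => monomialMul p Φ)
    (hΦ : ∀ z : bidisk, Φ z = φ z) (w v : bidisk) :
    1 - φ v * conj (φ w) = (1 - v.1.1 * conj w.1.1) * (k2min φ w) v +
      (1 - v.1.2 * conj w.1.2) * (k1max φ w) v := by
  have h : (S2min φ).starProjection (szego w) v =
      (1 - φ v * conj (φ w)) * szego w v - (S1max φ).starProjection (szego w) v := by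
    rw [starProjection_S2min, starProjection_modelSpace_szego hon hΦ, RKHS.coe_sub, RKHS.coe_sub,
      RKHS.coe_smul]
    simp only [Pi.sub_apply, Pi.smul_apply, mulIsometry_apply hon hΦ, smul_eq_mul]
    ring
  rw [k1max_apply, k2min_apply hon hΦ, h]
  linear_combination (-(1 - φ v * conj (φ w))) * szego_apply w v

theorem inner_k1max (w : bidisk) (f : HK1max φ) : ⟪k1max φ w, f⟫_ℂ = f w :=
  (RKHS.kerFun_inner (𝕜 := ℂ) (H := HK1max φ) w 1 f).trans (by simp)

theorem inner_k2min (w : bidisk) (f : HK2min φ) : ⟪k2min φ w, f⟫_ℂ = f w :=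
  (RKHS.kerFun_inner (𝕜 := ℂ) (H := HK2min φ) w 1 f).trans (by simp)

/-- The vectors `(1, conj w₁ k₂, conj w₂ k₁)` on which the model isometry is prescribed. -/
noncomputable def inputVector (φ : ℂ × ℂ → ℂ) (w : bidisk) : ColligationSpace φ :=
  WithLp.toLp 2 (1, statePair φ (conj w.1.1 • k2min φ w) (conj w.1.2 • k1max φ w))

/-- The prescribed images `(conj φ(w), k₂, k₁)`. -/
noncomputable def outputVector (φ : ℂ × ℂ → ℂ) (w : bidisk) : ColligationSpace φ :=
  WithLp.toLp 2 (conj (φ w), statePair φ (k2min φ w) (k1max φ w))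

theorem inner_inputVector (w : bidisk) (x : ColligationSpace φ) :
    ⟪inputVector φ w, x⟫_ℂ = x.fst + w.1.1 * x.snd.fst w + w.1.2 * x.snd.snd w := by
  rw [inputVector, statePair, WithLp.prod_inner_apply, WithLp.prod_inner_apply]
  simp [-Submodule.coe_inner, inner_smul_left, inner_k1max, inner_k2min, add_assoc]

theorem inner_outputVector (w : bidisk) (x : ColligationSpace φ) :
    ⟪outputVector φ w, x⟫_ℂ = φ w * x.fst + x.snd.fst w + x.snd.snd w := by
  rw [outputVector, statePair, WithLp.prod_inner_apply, WithLp.prod_inner_apply]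
  simp [-Submodule.coe_inner, inner_k1max, inner_k2min, add_assoc, mul_comm]

/-- This is the Agler decomposition with its negative terms moved to the other side. -/
theorem inner_inputVector_inputVector (hon : Orthonormal ℂ fun p => monomialMul p Φ)
    (hΦ : ∀ z : bidisk, Φ z = φ z) (v w : bidisk) :
    ⟪inputVector φ v, inputVector φ w⟫_ℂ = ⟪outputVector φ v, outputVector φ w⟫_ℂ := by
  rw [inner_inputVector, inner_outputVector]
  change 1 + v.1.1 * (conj w.1.1 • k2min φ w) v + v.1.2 * (conj w.1.2 • k1max φ w) v =
    φ v * conj (φ w) + k2min φ w v + k1max φ w v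
  rw [RKHS.coe_smul, RKHS.coe_smul]
  simp only [Pi.smul_apply, smul_eq_mul]
  linear_combination agler_decomposition hon hΦ w v

/-- Totality of the input vectors, used both for the existence and uniqueness of `V` and for
computing `V* (1, 0)`. -/
theorem eq_zero_of_inner_inputVector (hon : Orthonormal ℂ fun p => monomialMul p Φ)
    (hΦ : ∀ z : bidisk, Φ z = φ z) (x : ColligationSpace φ)
    (hx : ∀ w, ⟪inputVector φ w, x⟫_ℂ = 0) : x = 0 := by
  obtain ⟨⟨a, ⟨f₂, f₁⟩⟩⟩ := x
  have h : a • monomial 0 + monomialMul (1, 0) (f₂ : HardySpace) +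
      monomialMul (0, 1) (f₁ : HardySpace) = 0 := by
    refine RKHS.ext (𝕜 := ℂ) fun w => ?_
    have hw := hx w
    rw [inner_inputVector] at hw
    rw [RKHS.coe_add, RKHS.coe_add, RKHS.coe_smul, RKHS.coe_zero]
    simpa [monomialMul_apply, monomial_apply, coe_apply] using hw
  have ha : a = 0 := by
    have := congrArg (fun g => coeff g 0) h
    simpa [coeff_add, coeff_smul, coeff_monomial, coeff_monomialMul, coeff_zero] using this
  subst ha
  rw [zero_smul, zero_add] at h
  -- Apply `M₂*` to `z₁ f₂ = -z₂ f₁`.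
  have h1 : (f₁ : HardySpace) = -M₁ (backShift (0, 1) (f₂ : HardySpace)) := by
    rw [M₁_eq, monomialMul_backShift_comm', eq_neg_of_add_eq_zero_left h, map_neg, neg_neg,
      backShift_monomialMul]
  set g := backShift (0, 1) (f₂ : HardySpace) with hg
  have hf₁ : (f₁ : HardySpace) ∈ S1max φ := f₁.2.1
  have hgB : g = -backShift (1, 0) (f₁ : HardySpace) := by
    rw [h1, map_neg, neg_neg, M₁_eq, backShift_monomialMul]
  -- Membership of `g` in the model space comes from `g = -M₁* f₁`; the generator conditions come
  -- from `z₁ g = -f₁` and the invariance of `S1max φ`.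
  have hgS : g ∈ S1max φ := by
    refine (mem_S1max_iff hon hΦ).mpr ⟨(mem_modelSpace_iff hon hΦ).mpr fun p => ?_, fun p => ?_⟩
    · rw [hgB, inner_neg_left, inner_backShift_left, monomialMul_monomialMul,
        (mem_modelSpace_iff hon hΦ).mp (S1max_le_modelSpace hf₁), neg_zero]
    · have := (mem_modelSpace_iff hon hΦ).mp
        (S1max_le_modelSpace (monomialMul_mem_S1max hf₁ p.1)) (0, p.2)
      rw [h1, map_neg, inner_neg_left, neg_eq_zero, M₁_eq, monomialMul_monomialMul] at this
      rw [inner_S2gen]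
      simpa using this
  -- Now `f₁` lies in `z₁ S1max φ` and is also orthogonal to it.
  have hf₁0 : f₁ = 0 := by
    have h2 : ⟪M₁ g, (f₁ : HardySpace)⟫_ℂ = 0 := f₁.2.2 _ ⟨g, hgS, rfl⟩
    have h3 : M₁ g = -(f₁ : HardySpace) := by rw [h1, neg_neg]
    rw [h3, inner_neg_left, neg_eq_zero, inner_self_eq_zero] at h2
    exact Subtype.ext h2
  have hf₂0 : f₂ = 0 := by
    subst hf₁0
    refine Subtype.ext ?_
    have h2 : monomialMul (1, 0) (f₂ : HardySpace) = 0 := by simpa using h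
    rw [← backShift_monomialMul (1, 0) (f₂ : HardySpace), h2, map_zero]
    rfl
  subst hf₁0 hf₂0
  rfl

theorem existsUnique_isModelIsometry (hon : Orthonormal ℂ fun p => monomialMul p Φ)
    (hΦ : ∀ z : bidisk, Φ z = φ z) :
    ∃! V : ColligationSpace φ →ₗᵢ[ℂ] ColligationSpace φ, IsModelIsometry φ V := by
  refine existsUnique_linearIsometry (inputVector φ) (outputVector φ) ?_
    (inner_inputVector_inputVector hon hΦ)
  rw [Submodule.eq_bot_iff]
  refine fun x hx => eq_zero_of_inner_inputVector hon hΦ x fun w => ?_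
  exact (Submodule.mem_orthogonal _ _).mp hx _ (Submodule.subset_span ⟨w, rfl⟩)

/-- `M₁* Φ` lies in `S2min φ` and `M₂* Φ` in `S1max φ`, so each projection only subtracts a term
built from `M₁* M₂* Φ`. That function lies in the model space, so its two projections add up to it,
and `eq_add_backShift` applies. -/
theorem M₁_add_M₂_projections (hon : Orthonormal ℂ fun p => monomialMul p Φ)
    (hΦ : ∀ z : bidisk, Φ z = φ z) :
    M₁ (P₂ φ (backShift (1, 0) Φ) : HardySpace) + M₂ (P₁ φ (backShift (0, 1) Φ) : HardySpace) =
      Φ - coeff Φ 0 • monomial 0 := by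
  have hF₁ : (P₁ φ (backShift (0, 1) Φ) : HardySpace) = backShift (0, 1) Φ -
      M₁ ((S1max φ).starProjection (backShift (1, 1) Φ)) := by
    refine (starProjection_HK1max _).trans ?_
    rw [Submodule.starProjection_eq_self_iff.mpr (backShift_snd_mem_S1max hon hΦ),
      backShift_backShift]
    rfl
  have hmem : backShift (1, 0) Φ ∈ S2min φ := by
    have := S2gen_mem_S2min hon hΦ (0, 0)
    rwa [S2gen, monomialMul_zero] at this
  have hF₂ : (P₂ φ (backShift (1, 0) Φ) : HardySpace) = backShift (1, 0) Φ -
      M₂ ((S2min φ).starProjection (backShift (1, 1) Φ)) := by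
    refine (starProjection_HK2min hon hΦ _).trans ?_
    rw [Submodule.starProjection_eq_self_iff.mpr hmem, backShift_backShift]
    rfl
  have hK : backShift (1, 1) Φ ∈ modelSpace φ := by
    refine (mem_modelSpace_iff hon hΦ).mpr fun p => ?_
    rw [inner_backShift_left, monomialMul_monomialMul]
    nth_rewrite 1 [← monomialMul_zero Φ]
    exact inner_monomialMul_of_ne hon fun h => by simp [Prod.ext_iff] at h; lia
  rw [hF₁, hF₂, starProjection_S2min, Submodule.starProjection_eq_self_iff.mpr hK,
    ← eq_add_backShift, M₁_eq, M₂_eq]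
  simp only [map_sub, monomialMul_monomialMul, Prod.mk_add_mk, add_zero, zero_add]
  abel

theorem blockD_apply (hon : Orthonormal ℂ fun p => monomialMul p Φ)
    (hΦ : ∀ z : bidisk, Φ z = φ z) (V : ColligationSpace φ →ₗᵢ[ℂ] ColligationSpace φ)
    (hV : IsModelIsometry φ V) (w : bidisk) :
    blockD φ V (statePair φ (k2min φ w) (k1max φ w)) =
      statePair φ (conj w.1.1 • k2min φ w) (conj w.1.2 • k1max φ w) -
        conj (φ w) • statePair φ (P₂ φ (backShift (1, 0) Φ)) (P₁ φ (backShift (0, 1) Φ)) := by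
  have hVX : ∀ v, V (inputVector φ v) = outputVector φ v := hV
  set A := ContinuousLinearMap.adjoint V.toContinuousLinearMap with hA
  have hAV : ∀ x, A (V x) = x := fun x => ext_inner_left ℂ fun y => by
    rw [hA, ContinuousLinearMap.adjoint_inner_right]
    exact V.inner_map_map y x
  set F := statePair φ (P₂ φ (backShift (1, 0) Φ)) (P₁ φ (backShift (0, 1) Φ)) with hF
  -- Both sides have the same inner product with every input vector: on the left `V` turns the input
  -- into an output, giving `φ(v)`.
  have hA1 : A (WithLp.toLp 2 (1, 0)) = WithLp.toLp 2 (coeff Φ 0, F) := by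
    rw [← sub_eq_zero]
    refine eq_zero_of_inner_inputVector hon hΦ _ fun v => ?_
    rw [inner_sub_right, hA, ContinuousLinearMap.adjoint_inner_right,
      LinearIsometry.coe_toContinuousLinearMap, hVX, inner_outputVector, inner_inputVector]
    have h := congrArg (fun f : HardySpace => f v) (M₁_add_M₂_projections hon hΦ)
    simp only [RKHS.coe_add, RKHS.coe_sub, RKHS.coe_smul, Pi.add_apply, Pi.sub_apply,
      Pi.smul_apply, M₁_apply, M₂_apply, monomial_apply, hΦ] at h
    rw [hF, statePair]
    simp only [coe_apply]
    simp at h ⊢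
    linear_combination -h
  -- The state vector is an output vector, which `V*` sends back to its input, minus a multiple of
  -- `(1, 0)`.
  have hsplit : (WithLp.toLp 2 (0, statePair φ (k2min φ w) (k1max φ w)) : ColligationSpace φ) =
      outputVector φ w - conj (φ w) • WithLp.toLp 2 (1, 0) := by
    rw [outputVector, ← WithLp.toLp_smul, ← WithLp.toLp_sub]
    simp
  rw [blockD, ← hA, hsplit, map_sub, map_smul, hA1, ← hVX, hAV, inputVector]
  rfl

end Colligation

/-! ### Fourier analysis on the torus: Parseval's identity and radial limits. -/

section Torus

open MeasureTheory Filter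

/-- Normalized Lebesgue measure on `(0, 2π]`. -/
noncomputable def angleMeasure : Measure ℝ :=
  (ENNReal.ofReal (2 * Real.pi))⁻¹ • volume.restrict (Set.Ioc 0 (2 * Real.pi))

/-- Normalized Lebesgue measure on `(0, 2π]²`. -/
noncomputable def torusMeasure : Measure (ℝ × ℝ) := angleMeasure.prod angleMeasure

instance : IsProbabilityMeasure angleMeasure := by
  refine ⟨?_⟩
  rw [angleMeasure, Measure.smul_apply, Measure.restrict_apply_univ, Real.volume_Ioc, sub_zero,
    smul_eq_mul]
  exact ENNReal.inv_mul_cancel (by simpa using Real.pi_pos) ENNReal.ofReal_ne_top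

instance : IsProbabilityMeasure torusMeasure :=
  inferInstanceAs (IsProbabilityMeasure (angleMeasure.prod angleMeasure))

theorem angleMeasure_absolutelyContinuous : angleMeasure ≪ volume :=
  (Measure.smul_absolutelyContinuous).trans Measure.restrict_le_self.absolutelyContinuous

theorem torusMeasure_absolutelyContinuous : torusMeasure ≪ volume :=
  angleMeasure_absolutelyContinuous.prod angleMeasure_absolutelyContinuous

theorem integral_angleMeasure (f : ℝ → ℂ) :
    ∫ θ, f θ ∂angleMeasure = (2 * Real.pi)⁻¹ • ∫ θ in 0..2 * Real.pi, f θ := by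
  rw [angleMeasure, integral_smul_measure, intervalIntegral.integral_of_le Real.two_pi_pos.le,
    ENNReal.toReal_inv, ENNReal.toReal_ofReal Real.two_pi_pos.le]

/-- The point of the unit circle at angle `θ`. -/
noncomputable def unitExp (θ : ℝ) : ℂ := Complex.exp (θ * Complex.I)

theorem norm_unitExp (θ : ℝ) : ‖unitExp θ‖ = 1 := Complex.norm_exp_ofReal_mul_I θ

theorem unitExp_ne_zero (θ : ℝ) : unitExp θ ≠ 0 := Complex.exp_ne_zero _

@[fun_prop]
theorem continuous_unitExp : Continuous unitExp := by
  unfold unitExp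
  fun_prop

theorem circleMap_eq_unitExp (θ : ℝ) : circleMap 0 1 θ = unitExp θ := by
  simp [circleMap, unitExp]

theorem integral_conj_unitExp_pow_mul (m n : ℕ) :
    ∫ θ, conj (unitExp θ ^ m) * unitExp θ ^ n ∂angleMeasure = if m = n then 1 else 0 := by
  have h : ∀ θ : ℝ, conj (unitExp θ ^ m) * unitExp θ ^ n =
      Complex.exp (((n : ℂ) - m) * Complex.I * θ) := fun θ => by
    rw [unitExp, map_pow, ← Complex.exp_conj, ← Complex.exp_nat_mul, ← Complex.exp_nat_mul,
      ← Complex.exp_add]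
    congr 1
    simp only [map_mul, Complex.conj_ofReal, Complex.conj_I]
    ring
  simp only [h]
  split_ifs with hmn
  · simp [hmn]
  · rw [integral_angleMeasure, integral_exp_mul_complex]
    · have : Complex.exp (((n : ℂ) - m) * Complex.I * ((2 * Real.pi : ℝ) : ℂ)) = 1 := by
        rw [← Complex.exp_int_mul_two_pi_mul_I ((n : ℤ) - m)]
        congr 1
        push_cast
        ring
      rw [this]
      simp
    · refine mul_ne_zero (sub_ne_zero.mpr ?_) Complex.I_ne_zero
      exact_mod_cast Ne.symm hmn

/-- The restriction of the monomial `z₁ ^ p.1 * z₂ ^ p.2` to the torus. -/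
noncomputable def torusChar (p : ℕ × ℕ) (θ : ℝ × ℝ) : ℂ :=
  unitExp θ.1 ^ p.1 * unitExp θ.2 ^ p.2

theorem norm_torusChar (p : ℕ × ℕ) (θ : ℝ × ℝ) : ‖torusChar p θ‖ = 1 := by
  simp [torusChar, norm_unitExp]

@[fun_prop]
theorem continuous_torusChar (p : ℕ × ℕ) : Continuous (torusChar p) := by
  unfold torusChar
  fun_prop

theorem integral_conj_torusChar_mul (p q : ℕ × ℕ) :
    ∫ θ, conj (torusChar p θ) * torusChar q θ ∂torusMeasure = if p = q then 1 else 0 := by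
  have h : ∀ θ, conj (torusChar p θ) * torusChar q θ =
      (conj (unitExp θ.1 ^ p.1) * unitExp θ.1 ^ q.1) *
        (conj (unitExp θ.2 ^ p.2) * unitExp θ.2 ^ q.2) := fun θ => by
    simp only [torusChar, map_mul]
    ring
  simp only [h]
  rw [torusMeasure, integral_prod_mul (fun θ => conj (unitExp θ ^ p.1) * unitExp θ ^ q.1)
    (fun θ => conj (unitExp θ ^ p.2) * unitExp θ ^ q.2), integral_conj_unitExp_pow_mul,
    integral_conj_unitExp_pow_mul]
  simp only [Prod.ext_iff]
  split_ifs <;> simp_all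

theorem integrable_torus_of_bound {f : ℝ × ℝ → ℂ} (hf : Continuous f) (C : ℝ)
    (h : ∀ θ, ‖f θ‖ ≤ C) : Integrable f torusMeasure :=
  Integrable.of_bound hf.aestronglyMeasurable C (Eventually.of_forall h)

/-- Absolute summability allows the double series to be integrated term by term; orthogonality of
characters leaves the diagonal. -/
theorem hasSum_integral_conj_mul {a b : ℕ × ℕ → ℂ} (ha : Summable fun p => ‖a p‖)
    (hb : Summable fun p => ‖b p‖) :
    HasSum (fun p => conj (a p) * b p)
      (∫ θ, conj (∑' p, a p * torusChar p θ) * (∑' p, b p * torusChar p θ) ∂torusMeasure) := by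
  have ha' : ∀ θ, Summable fun p => ‖conj (a p * torusChar p θ)‖ := fun θ =>
    ha.congr fun p => by rw [RCLike.norm_conj, norm_mul, norm_torusChar, mul_one]
  have hb' : ∀ θ, Summable fun p => ‖b p * torusChar p θ‖ := fun θ =>
    hb.congr fun p => by rw [norm_mul, norm_torusChar, mul_one]
  have hnorm : ∀ (P : (ℕ × ℕ) × (ℕ × ℕ)) θ,
      ‖conj (a P.1 * torusChar P.1 θ) * (b P.2 * torusChar P.2 θ)‖ = ‖a P.1‖ * ‖b P.2‖ :=
    fun P θ => by
      rw [norm_mul, RCLike.norm_conj, norm_mul, norm_mul, norm_torusChar, norm_torusChar, mul_one,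
        mul_one]
  have h := hasSum_integral_of_summable_integral_norm (μ := torusMeasure)
    (F := fun (P : (ℕ × ℕ) × (ℕ × ℕ)) θ =>
      conj (a P.1 * torusChar P.1 θ) * (b P.2 * torusChar P.2 θ))
    (fun P => integrable_torus_of_bound (by fun_prop) _ fun θ => (hnorm P θ).le)
    (by
      simp only [hnorm, integral_const, probReal_univ, one_smul]
      exact ha.mul_of_nonneg hb (fun _ => norm_nonneg _) (fun _ => norm_nonneg _))
  have hint : ∀ P : (ℕ × ℕ) × (ℕ × ℕ),
      ∫ θ, conj (a P.1 * torusChar P.1 θ) * (b P.2 * torusChar P.2 θ) ∂torusMeasure =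
        if P.1 = P.2 then conj (a P.1) * b P.2 else 0 := fun P => by
    have : ∀ θ, conj (a P.1 * torusChar P.1 θ) * (b P.2 * torusChar P.2 θ) =
        conj (a P.1) * b P.2 * (conj (torusChar P.1 θ) * torusChar P.2 θ) := fun θ => by
      rw [map_mul]
      ring
    simp only [this]
    rw [integral_const_mul, integral_conj_torusChar_mul]
    simp
  simp only [hint] at h
  have hdiag : Function.Injective fun p : ℕ × ℕ => (p, p) := fun p q hpq => congrArg Prod.fst hpq
  have htsum : ∀ θ, conj (∑' p, a p * torusChar p θ) * (∑' p, b p * torusChar p θ) =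
      ∑' P : (ℕ × ℕ) × (ℕ × ℕ), conj (a P.1 * torusChar P.1 θ) * (b P.2 * torusChar P.2 θ) :=
    fun θ => by rw [Complex.conj_tsum, tsum_mul_tsum_of_summable_norm (ha' θ) (hb' θ)]
  simp only [htsum]
  rw [← hdiag.hasSum_iff] at h
  · exact hasSum_of_eq (fun p => by simp) h
  · rintro ⟨p, q⟩ hpq
    exact if_neg fun e : p = q => hpq ⟨p, by rw [e]⟩

/-- The point `(r exp (i θ₁), r exp (i θ₂))`. -/
noncomputable def radialPoint (r : ℝ) (θ : ℝ × ℝ) : ℂ × ℂ := (r * unitExp θ.1, r * unitExp θ.2)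

@[fun_prop]
theorem continuous_radialPoint (r : ℝ) : Continuous (radialPoint r) := by
  unfold radialPoint
  fun_prop

theorem mem_bidisk_iff {z : ℂ × ℂ} : z ∈ bidisk ↔ ‖z.1‖ < 1 ∧ ‖z.2‖ < 1 := by
  simp [bidisk]

theorem isOpen_bidisk : IsOpen bidisk := Metric.isOpen_ball.prod Metric.isOpen_ball

theorem radialPoint_mem {r : ℝ} (hr : r ∈ Set.Ioo (0 : ℝ) 1) (θ : ℝ × ℝ) :
    radialPoint r θ ∈ bidisk := by
  rw [mem_bidisk_iff]
  simp [radialPoint, norm_unitExp, abs_of_pos hr.1, hr.2]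

theorem radialPoint_monomial (r : ℝ) (θ : ℝ × ℝ) (p : ℕ × ℕ) :
    (radialPoint r θ).1 ^ p.1 * (radialPoint r θ).2 ^ p.2 =
      (r : ℂ) ^ (p.1 + p.2) * torusChar p θ := by
  simp only [radialPoint, torusChar, mul_pow, pow_add]
  ring

theorem Ioo_mem_nhdsLT_one : Set.Ioo (0 : ℝ) 1 ∈ 𝓝[<] (1 : ℝ) := Ioo_mem_nhdsLT one_pos

/-- For `r < 1` the coefficients `a p * r^(p.1 + p.2)` are absolutely summable, so Parseval's
identity applies. -/
theorem hasSum_integral_radial {a b : ℕ × ℕ → ℂ} {F G : ℂ × ℂ → ℂ}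
    (hF : ∀ z ∈ bidisk, HasSum (fun p => a p * (z.1 ^ p.1 * z.2 ^ p.2)) (F z))
    (hG : ∀ z ∈ bidisk, HasSum (fun p => b p * (z.1 ^ p.1 * z.2 ^ p.2)) (G z))
    {r : ℝ} (hr : r ∈ Set.Ioo (0 : ℝ) 1) :
    HasSum (fun p => conj (a p) * b p * ((r ^ (2 * (p.1 + p.2)) : ℝ) : ℂ))
      (∫ θ, conj (F (radialPoint r θ)) * G (radialPoint r θ) ∂torusMeasure) := by
  have key : ∀ {a : ℕ × ℕ → ℂ} {F : ℂ × ℂ → ℂ},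
      (∀ z ∈ bidisk, HasSum (fun p => a p * (z.1 ^ p.1 * z.2 ^ p.2)) (F z)) →
      (Summable fun p => ‖a p * (r : ℂ) ^ (p.1 + p.2)‖) ∧
      ∀ θ, F (radialPoint r θ) = ∑' p, a p * (r : ℂ) ^ (p.1 + p.2) * torusChar p θ := by
    intro a F hF
    have h : ∀ θ, HasSum (fun p => a p * (r : ℂ) ^ (p.1 + p.2) * torusChar p θ)
        (F (radialPoint r θ)) := fun θ =>
      hasSum_of_eq (fun p => by rw [radialPoint_monomial, mul_assoc])
        (hF _ (radialPoint_mem hr θ))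
    refine ⟨(h 0).summable.norm.congr fun p => ?_, fun θ => (h θ).tsum_eq.symm⟩
    rw [norm_mul, norm_torusChar, mul_one]
  obtain ⟨ha, hFs⟩ := key hF
  obtain ⟨hb, hGs⟩ := key hG
  have h := hasSum_integral_conj_mul ha hb
  simp only [← hFs, ← hGs] at h
  refine hasSum_of_eq (fun p => ?_) h
  simp only [map_mul, map_pow, Complex.conj_ofReal]
  push_cast
  ring

/-- Square-summability of Taylor coefficients of a function bounded by one. -/
theorem summable_norm_sq_of_bounded {a : ℕ × ℕ → ℂ} {F : ℂ × ℂ → ℂ}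
    (hF : ∀ z ∈ bidisk, HasSum (fun p => a p * (z.1 ^ p.1 * z.2 ^ p.2)) (F z))
    (hbd : ∀ z ∈ bidisk, ‖F z‖ ≤ 1) : Summable fun p => ‖a p‖ ^ 2 := by
  refine summable_of_sum_le (c := 1) (fun p => by positivity) fun s => ?_
  have hlim : Tendsto (fun r : ℝ => ∑ p ∈ s, ‖a p‖ ^ 2 * r ^ (2 * (p.1 + p.2))) (𝓝[<] 1)
      (𝓝 (∑ p ∈ s, ‖a p‖ ^ 2)) := by
    have : Continuous fun r : ℝ => ∑ p ∈ s, ‖a p‖ ^ 2 * r ^ (2 * (p.1 + p.2)) := by fun_prop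
    simpa using (this.tendsto 1).mono_left nhdsWithin_le_nhds
  refine le_of_tendsto hlim ?_
  filter_upwards [Ioo_mem_nhdsLT_one] with r hr
  have h := hasSum_integral_radial hF hF hr
  have h' : HasSum (fun p => ‖a p‖ ^ 2 * r ^ (2 * (p.1 + p.2)))
      (∫ θ, conj (F (radialPoint r θ)) * F (radialPoint r θ) ∂torusMeasure).re := by
    convert Complex.hasSum_re h using 2 with p
    rw [Complex.re_mul_ofReal, Complex.conj_mul', ← Complex.ofReal_pow, Complex.ofReal_re]
  refine (sum_le_hasSum s (fun p _ => ?_) h').trans ?_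
  · have := hr.1
    positivity
  · refine (Complex.re_le_norm _).trans ?_
    refine (norm_integral_le_of_norm_le_const (C := 1) (Eventually.of_forall fun θ => ?_)).trans ?_
    · rw [norm_mul, RCLike.norm_conj]
      have := hbd _ (radialPoint_mem hr θ)
      nlinarith [norm_nonneg (F (radialPoint r θ))]
    · simp

/-- Dominated convergence for the Parseval series, with `‖a p‖ ‖b p‖ ≤ ‖a p‖² + ‖b p‖²` as bound. -/
theorem tendsto_integral_radial {a b : ℕ × ℕ → ℂ} {F G : ℂ × ℂ → ℂ}
    (hF : ∀ z ∈ bidisk, HasSum (fun p => a p * (z.1 ^ p.1 * z.2 ^ p.2)) (F z))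
    (hG : ∀ z ∈ bidisk, HasSum (fun p => b p * (z.1 ^ p.1 * z.2 ^ p.2)) (G z))
    (ha : Summable fun p => ‖a p‖ ^ 2) (hb : Summable fun p => ‖b p‖ ^ 2) :
    Tendsto (fun r => ∫ θ, conj (F (radialPoint r θ)) * G (radialPoint r θ) ∂torusMeasure)
      (𝓝[<] 1) (𝓝 (∑' p, conj (a p) * b p)) := by
  have h : Tendsto (fun r : ℝ => ∑' p, conj (a p) * b p * ((r ^ (2 * (p.1 + p.2)) : ℝ) : ℂ))
      (𝓝[<] 1) (𝓝 (∑' p, conj (a p) * b p)) := by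
    refine tendsto_tsum_of_dominated_convergence (bound := fun p => ‖a p‖ ^ 2 + ‖b p‖ ^ 2)
      (ha.add hb) (fun p => ?_) ?_
    · have : Continuous fun r : ℝ => conj (a p) * b p * ((r ^ (2 * (p.1 + p.2)) : ℝ) : ℂ) := by
        fun_prop
      simpa using (this.tendsto 1).mono_left nhdsWithin_le_nhds
    · filter_upwards [Ioo_mem_nhdsLT_one] with r hr p
      rw [norm_mul, norm_mul, RCLike.norm_conj, Complex.norm_real, Real.norm_eq_abs,
        abs_of_pos (pow_pos hr.1 _)]
      have h1 : r ^ (2 * (p.1 + p.2)) ≤ 1 := pow_le_one₀ hr.1.le hr.2.le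
      have h2 : ‖a p‖ * ‖b p‖ * r ^ (2 * (p.1 + p.2)) ≤ ‖a p‖ * ‖b p‖ :=
        mul_le_of_le_one_right (by positivity) h1
      nlinarith [sq_nonneg (‖a p‖ - ‖b p‖), sq_nonneg (‖a p‖ + ‖b p‖)]
  refine h.congr' ?_
  filter_upwards [Ioo_mem_nhdsLT_one] with r hr
  exact (hasSum_integral_radial hF hG hr).tsum_eq

/-! ### Cauchy's formula, boundary values and Taylor expansion of inner functions. -/

theorem norm_mul_inv_unitExp (z : ℂ) (θ : ℝ) : ‖z * (unitExp θ)⁻¹‖ = ‖z‖ := by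
  rw [norm_mul, norm_inv, norm_unitExp, inv_one, mul_one]

/-- Cauchy's formula on the circle of radius `r`. -/
theorem integral_cauchyKernel_mul {f : ℂ → ℂ} (hf : DifferentiableOn ℂ f (Metric.ball 0 1)) {r : ℝ}
    (hr : r ∈ Set.Ioo (0 : ℝ) 1) {z : ℂ} (hz : ‖z‖ < 1) :
    ∫ θ, (1 - z * (unitExp θ)⁻¹)⁻¹ * f (r * unitExp θ) ∂angleMeasure = f (r * z) := by
  have hd : DiffContOnCl ℂ (fun ζ : ℂ => f (r * ζ)) (Metric.ball 0 |(1 : ℝ)|) := by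
    refine DifferentiableOn.diffContOnCl (hf.comp (by fun_prop) fun ζ hζ => ?_)
    rw [abs_one, closure_ball _ one_ne_zero, mem_closedBall_zero_iff] at hζ
    rw [mem_ball_zero_iff, norm_mul, Complex.norm_real, Real.norm_eq_abs, abs_of_pos hr.1]
    nlinarith [hr.1, hr.2, norm_nonneg ζ]
  have h := hd.circleAverage_smul_div (w := z) (by simpa using hz)
  rw [← h, Real.circleAverage_def, integral_angleMeasure]
  congr 2
  funext θ
  have hne := unitExp_ne_zero θ
  have hsub : unitExp θ - z ≠ 0 := fun h0 => by
    have := norm_unitExp θ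
    rw [sub_eq_zero.mp h0] at this
    linarith
  have hsub' : 1 - z * (unitExp θ)⁻¹ = (unitExp θ - z) / unitExp θ := by field_simp
  rw [circleMap_eq_unitExp, smul_eq_mul, sub_zero, hsub', inv_div]

/-- The Cauchy kernel of the bidisk. -/
noncomputable def cauchyKernel (z : ℂ × ℂ) (θ : ℝ × ℝ) : ℂ :=
  (1 - z.1 * (unitExp θ.1)⁻¹)⁻¹ * (1 - z.2 * (unitExp θ.2)⁻¹)⁻¹

theorem one_sub_mul_inv_unitExp_ne_zero {z : ℂ} (hz : ‖z‖ < 1) (θ : ℝ) :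
    1 - z * (unitExp θ)⁻¹ ≠ 0 := fun h => by
  have := norm_mul_inv_unitExp z θ
  rw [← sub_eq_zero.mp h, norm_one] at this
  linarith

theorem continuous_cauchyKernel {z : ℂ × ℂ} (hz : z ∈ bidisk) : Continuous (cauchyKernel z) := by
  rw [mem_bidisk_iff] at hz
  have h := unitExp_ne_zero
  unfold cauchyKernel
  refine .mul (.inv₀ ?_ fun θ => one_sub_mul_inv_unitExp_ne_zero hz.1 _)
    (.inv₀ ?_ fun θ => one_sub_mul_inv_unitExp_ne_zero hz.2 _)
  · exact continuous_const.sub (continuous_const.mul ((by fun_prop :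
      Continuous fun θ : ℝ × ℝ => unitExp θ.1).inv₀ fun θ => h _))
  · exact continuous_const.sub (continuous_const.mul ((by fun_prop :
      Continuous fun θ : ℝ × ℝ => unitExp θ.2).inv₀ fun θ => h _))

theorem norm_inv_one_sub_le {z : ℂ} (hz : ‖z‖ < 1) (θ : ℝ) :
    ‖(1 - z * (unitExp θ)⁻¹)⁻¹‖ ≤ (1 - ‖z‖)⁻¹ := by
  rw [norm_inv]
  refine inv_anti₀ (by linarith) ?_
  have := norm_sub_norm_le (1 : ℂ) (z * (unitExp θ)⁻¹)
  rwa [norm_one, norm_mul_inv_unitExp] at this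

theorem norm_cauchyKernel_le {z : ℂ × ℂ} (hz : z ∈ bidisk) (θ : ℝ × ℝ) :
    ‖cauchyKernel z θ‖ ≤ (1 - ‖z.1‖)⁻¹ * (1 - ‖z.2‖)⁻¹ := by
  rw [mem_bidisk_iff] at hz
  rw [cauchyKernel, norm_mul]
  exact mul_le_mul (norm_inv_one_sub_le hz.1 _) (norm_inv_one_sub_le hz.2 _) (norm_nonneg _)
    (inv_nonneg.mpr (by linarith))

theorem continuous_comp_radialPoint {φ : ℂ × ℂ → ℂ} (hφ : DifferentiableOn ℂ φ bidisk) {r : ℝ}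
    (hr : r ∈ Set.Ioo (0 : ℝ) 1) : Continuous fun θ => φ (radialPoint r θ) :=
  hφ.continuousOn.comp_continuous (by fun_prop) (radialPoint_mem hr)

/-- Cauchy's formula on the torus of radius `r`. -/
theorem integral_cauchyKernel_radial {φ : ℂ × ℂ → ℂ} (hφ : DifferentiableOn ℂ φ bidisk)
    {C : ℝ} (hbd : ∀ z ∈ bidisk, ‖φ z‖ ≤ C) {r : ℝ} (hr : r ∈ Set.Ioo (0 : ℝ) 1) {z : ℂ × ℂ}
    (hz : z ∈ bidisk) :
    ∫ θ, cauchyKernel z θ * φ (radialPoint r θ) ∂torusMeasure = φ (r * z.1, r * z.2) := by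
  have hint : Integrable (fun θ => cauchyKernel z θ * φ (radialPoint r θ)) torusMeasure :=
    integrable_torus_of_bound
      ((continuous_cauchyKernel hz).mul (continuous_comp_radialPoint hφ hr))
      ((1 - ‖z.1‖)⁻¹ * (1 - ‖z.2‖)⁻¹ * C) fun θ => by
        rw [norm_mul]
        exact mul_le_mul (norm_cauchyKernel_le hz θ) (hbd _ (radialPoint_mem hr θ))
          (norm_nonneg _) ((norm_nonneg _).trans (norm_cauchyKernel_le hz θ))
  have hz' := mem_bidisk_iff.mp hz
  have hsc : ∀ {ζ : ℂ}, ‖ζ‖ ≤ 1 → ‖(r : ℂ) * ζ‖ < 1 := fun {ζ} hζ => by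
    rw [norm_mul, Complex.norm_real, Real.norm_eq_abs, abs_of_pos hr.1]
    nlinarith [hr.1, hr.2, norm_nonneg ζ]
  rw [torusMeasure, integral_prod _ hint]
  have hinner : ∀ θ₁ : ℝ, ∫ θ₂, cauchyKernel z (θ₁, θ₂) * φ (radialPoint r (θ₁, θ₂))
      ∂angleMeasure = (1 - z.1 * (unitExp θ₁)⁻¹)⁻¹ * φ (r * unitExp θ₁, r * z.2) := fun θ₁ => by
    have h := integral_cauchyKernel_mul (f := fun ζ => φ (r * unitExp θ₁, ζ))
      (hφ.comp (by fun_prop) fun ζ hζ => mem_bidisk_iff.mpr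
        ⟨hsc (norm_unitExp θ₁).le, by simpa using hζ⟩) hr hz'.2
    rw [← h, ← integral_const_mul]
    simp only [cauchyKernel, radialPoint, mul_assoc]
  simp only [hinner]
  exact integral_cauchyKernel_mul (f := fun ζ => φ (ζ, r * z.2))
    (hφ.comp (by fun_prop) fun ζ hζ => mem_bidisk_iff.mpr
      ⟨by simpa using hζ, hsc hz'.2.le⟩) hr hz'.1

/-- A radial boundary function of an inner function. -/
theorem IsInnerFunction.exists_boundary {φ : ℂ × ℂ → ℂ} (hφ : IsInnerFunction φ) :
    ∃ ψ : ℝ × ℝ → ℂ, AEStronglyMeasurable ψ torusMeasure ∧ ∀ᵐ θ ∂torusMeasure, ‖ψ θ‖ = 1 ∧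
      Tendsto (fun r => φ (radialPoint r θ)) (𝓝[<] 1) (𝓝 (ψ θ)) := by
  obtain ⟨ψ, hψ⟩ := Eventually.choice
    (torusMeasure_absolutelyContinuous.ae_le hφ.radial_limit)
  refine ⟨ψ, ?_, hψ⟩
  -- The chosen `ψ` is measurable as an almost everywhere limit of continuous functions, along radii
  -- in `(0, 1)` tending to `1`.
  obtain ⟨u, -, hu, hlim⟩ := exists_seq_strictMono_tendsto' (one_pos : (0 : ℝ) < 1)
  have hlim' : Tendsto u atTop (𝓝[<] 1) :=
    tendsto_nhdsWithin_iff.mpr ⟨hlim, Eventually.of_forall fun n => (hu n).2⟩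
  refine aestronglyMeasurable_of_tendsto_ae atTop (f := fun n θ => φ (radialPoint (u n) θ))
    (fun n => (continuous_comp_radialPoint hφ.differentiableOn (hu n)).aestronglyMeasurable) ?_
  filter_upwards [hψ] with θ hθ
  exact hθ.2.comp hlim'

/-- An inner function has a Taylor expansion on the bidisk. -/
theorem IsInnerFunction.exists_hasSum {φ : ℂ × ℂ → ℂ} (hφ : IsInnerFunction φ) :
    ∃ a : ℕ × ℕ → ℂ, ∀ z ∈ bidisk, HasSum (fun p => a p * (z.1 ^ p.1 * z.2 ^ p.2)) (φ z) := by
  obtain ⟨ψ, hψm, hψ⟩ := hφ.exists_boundary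
  -- The Taylor coefficients are the Fourier coefficients of the boundary function.
  refine ⟨fun p => ∫ θ, ((unitExp θ.1)⁻¹ ^ p.1 * (unitExp θ.2)⁻¹ ^ p.2) * ψ θ ∂torusMeasure,
    fun z hz => ?_⟩
  have hz' := mem_bidisk_iff.mp hz
  -- Let `r` tend to `1` in Cauchy's formula on the torus of radius `r`; `|φ| < 1` makes the kernel
  -- bound dominating.
  have hcauchy : ∫ θ, cauchyKernel z θ * ψ θ ∂torusMeasure = φ z := by
    have h1 : Tendsto (fun r => ∫ θ, cauchyKernel z θ * φ (radialPoint r θ) ∂torusMeasure)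
        (𝓝[<] 1) (𝓝 (∫ θ, cauchyKernel z θ * ψ θ ∂torusMeasure)) := by
      refine tendsto_integral_filter_of_dominated_convergence
        (fun _ => (1 - ‖z.1‖)⁻¹ * (1 - ‖z.2‖)⁻¹) ?_ ?_ (integrable_const _) ?_
      · filter_upwards [Ioo_mem_nhdsLT_one] with r hr
        exact ((continuous_cauchyKernel hz).mul
          (continuous_comp_radialPoint hφ.differentiableOn hr)).aestronglyMeasurable
      · filter_upwards [Ioo_mem_nhdsLT_one] with r hr
        refine Eventually.of_forall fun θ => ?_
        rw [norm_mul]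
        exact (mul_le_of_le_one_right (norm_nonneg _)
          (hφ.norm_lt_one _ (radialPoint_mem hr θ)).le).trans (norm_cauchyKernel_le hz θ)
      · filter_upwards [hψ] with θ hθ
        exact hθ.2.const_mul _
    have h2 : Tendsto (fun r : ℝ => φ (r * z.1, r * z.2)) (𝓝[<] 1) (𝓝 (φ z)) := by
      have hc : Tendsto (fun r : ℝ => ((r * z.1, r * z.2) : ℂ × ℂ)) (𝓝 1) (𝓝 z) := by
        have : Continuous fun r : ℝ => ((r * z.1, r * z.2) : ℂ × ℂ) := by fun_prop
        simpa using this.tendsto 1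
      exact (((hφ.differentiableOn.continuousOn.continuousAt
        (isOpen_bidisk.mem_nhds hz)).tendsto).comp hc).mono_left nhdsWithin_le_nhds
    refine tendsto_nhds_unique h1 (h2.congr' ?_)
    filter_upwards [Ioo_mem_nhdsLT_one] with r hr
    exact (integral_cauchyKernel_radial hφ.differentiableOn
      (fun z hz => (hφ.norm_lt_one z hz).le) hr hz).symm
  -- The terms of the geometric expansion of the Cauchy kernel, to be integrated against `ψ` one by
  -- one.
  let K : ℕ × ℕ → ℝ × ℝ → ℂ := fun p θ =>
    (z.1 * (unitExp θ.1)⁻¹) ^ p.1 * (z.2 * (unitExp θ.2)⁻¹) ^ p.2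
  have hKnorm : ∀ p θ, ‖K p θ‖ = ‖z.1‖ ^ p.1 * ‖z.2‖ ^ p.2 := fun p θ => by
    simp only [K, norm_mul, norm_pow, norm_inv, norm_unitExp, inv_one, mul_one]
  have hKcont : ∀ p, Continuous (K p) := fun p => by
    have h1 : Continuous fun θ : ℝ × ℝ => (unitExp θ.1)⁻¹ :=
      (by fun_prop : Continuous fun θ : ℝ × ℝ => unitExp θ.1).inv₀ fun θ => unitExp_ne_zero _
    have h2 : Continuous fun θ : ℝ × ℝ => (unitExp θ.2)⁻¹ :=
      (by fun_prop : Continuous fun θ : ℝ × ℝ => unitExp θ.2).inv₀ fun θ => unitExp_ne_zero _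
    fun_prop
  have hKsum : ∀ θ, ∑' p, K p θ * ψ θ = cauchyKernel z θ * ψ θ := fun θ => by
    have h1 : ‖z.1 * (unitExp θ.1)⁻¹‖ < 1 := by rw [norm_mul_inv_unitExp]; exact hz'.1
    have h2 : ‖z.2 * (unitExp θ.2)⁻¹‖ < 1 := by rw [norm_mul_inv_unitExp]; exact hz'.2
    rw [tsum_mul_right, cauchyKernel, ← tsum_geometric_of_norm_lt_one h1,
      ← tsum_geometric_of_norm_lt_one h2,
      tsum_mul_tsum_of_summable_norm (summable_norm_geometric_of_norm_lt_one h1)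
        (summable_norm_geometric_of_norm_lt_one h2)]
  have hKψ : ∀ p, ∀ᵐ θ ∂torusMeasure, ‖K p θ * ψ θ‖ = ‖z.1‖ ^ p.1 * ‖z.2‖ ^ p.2 := fun p => by
    filter_upwards [hψ] with θ hθ
    rw [norm_mul, hθ.1, mul_one, hKnorm]
  have h := hasSum_integral_of_summable_integral_norm (μ := torusMeasure)
    (F := fun p θ => K p θ * ψ θ)
    (fun p => Integrable.of_bound ((hKcont p).aestronglyMeasurable.mul hψm) _
      ((hKψ p).mono fun θ hθ => hθ.le))
    (by
      have : ∀ p, ∫ θ, ‖K p θ * ψ θ‖ ∂torusMeasure = ‖z.1‖ ^ p.1 * ‖z.2‖ ^ p.2 := fun p => by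
        rw [integral_congr_ae (hKψ p)]
        simp
      simp only [this]
      exact (summable_geometric_of_lt_one (norm_nonneg _) hz'.1).mul_of_nonneg
        (summable_geometric_of_lt_one (norm_nonneg _) hz'.2) (fun _ => by positivity)
        (fun _ => by positivity))
  simp only [hKsum, hcauchy] at h
  refine hasSum_of_eq (fun p => ?_) h
  rw [← integral_mul_const]
  refine integral_congr_ae (Eventually.of_forall fun θ => ?_)
  simp only [K, mul_pow]
  ring

/-- An inner function belongs to the Hardy space. -/
theorem IsInnerFunction.exists_hardySpace {φ : ℂ × ℂ → ℂ} (hφ : IsInnerFunction φ) :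
    ∃ Φ : HardySpace, ∀ z : bidisk, Φ z = φ z := by
  obtain ⟨a, ha⟩ := hφ.exists_hasSum
  have hs := summable_norm_sq_of_bounded ha fun z hz => (hφ.norm_lt_one z hz).le
  refine ⟨ofCoeff a ((memlp_iff a).mpr hs), fun z => ?_⟩
  refine (hasSum_apply _ z).unique (hasSum_of_eq (fun p => ?_) (ha z z.2))
  rw [coeff_ofCoeff, mul_assoc]

/-- The only use of unimodularity beyond boundedness of `ψ`: in the limit `r → 1` the factor `conj ψ
* ψ` equals `1`, and the inner product becomes that of two characters. -/
theorem IsInnerFunction.orthonormal {φ : ℂ × ℂ → ℂ} (hφ : IsInnerFunction φ) {Φ : HardySpace}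
    (hΦ : ∀ z : bidisk, Φ z = φ z) : Orthonormal ℂ fun p => monomialMul p Φ := by
  rw [orthonormal_iff_ite]
  intro p q
  obtain ⟨ψ, hψm, hψ⟩ := hφ.exists_boundary
  let F : ℕ × ℕ → ℂ × ℂ → ℂ := fun p z => z.1 ^ p.1 * z.2 ^ p.2 * φ z
  have hF : ∀ p, ∀ z ∈ bidisk,
      HasSum (fun q => coeff (monomialMul p Φ) q * (z.1 ^ q.1 * z.2 ^ q.2)) (F p z) :=
    fun p z hz => by
      have h := hasSum_apply (monomialMul p Φ) ⟨z, hz⟩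
      rw [monomialMul_apply, hΦ] at h
      exact hasSum_of_eq (fun q => mul_assoc _ _ _) h
  have hsq : ∀ f : HardySpace, Summable fun p => ‖coeff f p‖ ^ 2 :=
    fun f => (hasSum_norm_sq f).summable
  have h1 := tendsto_integral_radial (hF p) (hF q) (hsq _) (hsq _)
  have hinner : ∑' r, conj (coeff (monomialMul p Φ) r) * coeff (monomialMul q Φ) r =
      ⟪monomialMul p Φ, monomialMul q Φ⟫_ℂ :=
    (hasSum_of_eq (fun r => by rw [RCLike.inner_apply, mul_comm])
      (hasSum_inner (monomialMul p Φ) (monomialMul q Φ))).tsum_eq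
  rw [hinner] at h1
  refine tendsto_nhds_unique h1 ?_
  rw [← integral_conj_torusChar_mul]
  have hFr : ∀ p r θ, F p (radialPoint r θ) =
      (r : ℂ) ^ (p.1 + p.2) * torusChar p θ * φ (radialPoint r θ) := fun p r θ => by
    rw [← radialPoint_monomial]
  have hFc : ∀ p {r : ℝ}, r ∈ Set.Ioo (0 : ℝ) 1 → Continuous fun θ => F p (radialPoint r θ) :=
    fun p r hr => by
      simp only [hFr]
      exact (by fun_prop : Continuous fun θ => (r : ℂ) ^ (p.1 + p.2) * torusChar p θ).mul
        (continuous_comp_radialPoint hφ.differentiableOn hr)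
  have hFb : ∀ p {r : ℝ}, r ∈ Set.Ioo (0 : ℝ) 1 → ∀ θ, ‖F p (radialPoint r θ)‖ ≤ 1 :=
    fun p r hr θ => by
      rw [hFr, norm_mul, norm_mul, norm_torusChar, mul_one, norm_pow, Complex.norm_real,
        Real.norm_eq_abs, abs_of_pos hr.1]
      exact mul_le_one₀ (pow_le_one₀ hr.1.le hr.2.le) (norm_nonneg _)
        (hφ.norm_lt_one _ (radialPoint_mem hr θ)).le
  have hFl : ∀ p θ, Tendsto (fun r => φ (radialPoint r θ)) (𝓝[<] 1) (𝓝 (ψ θ)) →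
      Tendsto (fun r => F p (radialPoint r θ)) (𝓝[<] 1) (𝓝 (torusChar p θ * ψ θ)) :=
    fun p θ hθ => by
      simp only [hFr]
      have hc : Continuous fun r : ℝ => (r : ℂ) ^ (p.1 + p.2) * torusChar p θ := by fun_prop
      have := (hc.tendsto 1).mono_left (nhdsWithin_le_nhds (s := Set.Iio 1))
      simp only [Complex.ofReal_one, one_pow, one_mul] at this
      exact this.mul hθ
  refine tendsto_integral_filter_of_dominated_convergence (fun _ => 1) ?_ ?_
    (integrable_const _) ?_
  · filter_upwards [Ioo_mem_nhdsLT_one] with r hr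
    exact ((Complex.continuous_conj.comp (hFc p hr)).mul (hFc q hr)).aestronglyMeasurable
  · filter_upwards [Ioo_mem_nhdsLT_one] with r hr
    refine Eventually.of_forall fun θ => ?_
    rw [norm_mul, RCLike.norm_conj]
    exact mul_le_one₀ (hFb p hr θ) (norm_nonneg _) (hFb q hr θ)
  · filter_upwards [hψ] with θ hθ
    have h := ((Complex.continuous_conj.tendsto _).comp (hFl p θ hθ.2)).mul (hFl q θ hθ.2)
    have hval : conj (torusChar p θ * ψ θ) * (torusChar q θ * ψ θ) =
        conj (torusChar p θ) * torusChar q θ := by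
      have h1 : conj (ψ θ) * ψ θ = 1 := by
        rw [Complex.conj_mul', hθ.1]
        norm_num
      rw [map_mul]
      linear_combination (conj (torusChar p θ) * torusChar q θ) * h1
    rw [hval] at h
    exact h

end Torus

theorem proposition2 (φ : ℂ × ℂ → ℂ) (hφ : IsInnerFunction φ) :
    (∃! Φ : HardySpace, ∀ z : bidisk, Φ z = φ z) ∧
    (∃! V : ColligationSpace φ →ₗᵢ[ℂ] ColligationSpace φ, IsModelIsometry φ V) ∧
    ∀ Φ : HardySpace, (∀ z : bidisk, Φ z = φ z) →
      ∀ V : ColligationSpace φ →ₗᵢ[ℂ] ColligationSpace φ, IsModelIsometry φ V →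
        ∀ w : bidisk,
          blockD φ V (statePair φ (k2min φ w) (k1max φ w)) =
            statePair φ (conj w.1.1 • k2min φ w) (conj w.1.2 • k1max φ w) -
              conj (φ w) •
                statePair φ (P₂ φ (ContinuousLinearMap.adjoint M₁ Φ))
                  (P₁ φ (ContinuousLinearMap.adjoint M₂ Φ)) := by
  obtain ⟨Φ, hΦ⟩ := hφ.exists_hardySpace
  refine ⟨⟨Φ, hΦ, fun Ψ hΨ => RKHS.ext (𝕜 := ℂ) fun z => by rw [hΨ, hΦ]⟩,
    existsUnique_isModelIsometry (hφ.orthonormal hΦ) hΦ, fun Ψ hΨ V hV w => ?_⟩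
  exact blockD_apply (hφ.orthonormal hΨ) hΨ V hV w
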